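/- Let $X$ and $S$ be real analytic manifolds (finite-dimensional, Hausdorff, second countable). Let $\mathrm{op}(X_{sa})$ be the set of subanalytic open subsets of $X$; a family $T$ of subanalytic open subsets of $U\in\mathrm{op}(X_{sa})$ is a covering of $U$ in $X_{sa}$ if for every compact $K\subset X$ there is a finite $T_0\subset T$ with $K\cap\bigcup_{U'\in T_0}U'=K\cap U$. Let $\mathrm{op}(S)$ be the set of open subsets of $S$, with the usual open coverings. The relative site $X_{sa}\times S$ is defined as follows. Its objects are the finite unions of products $U\times V$ with $U\in\mathrm{op}(X_{sa})$, $V\in\mathrm{op}(S)$, ordered by inclusion. A family $T$ of objects contained in an object $W$ is a covering of $W$ if, for every product $U\times V\subset W$ with $U\in\mathrm{op}(X_{sa})$ and $V\in\mathrm{op}(S)$, the family $\{W'\cap(U\times V): W'\in T\}$ has a refinement $\{U_i\times V_j\}_{i\in I,j\in J}$ with $\{U_i\}_{i\in I}$ a covering of $U$ in $X_{sa}$ and $\{V_j\}_{j\in J}$ an open covering of $V$. Let $\mathrm{Mod}(\mathbb{C}_{X_{sa}\times S})$ be the abelian category of sheaves of $\mathbb{C}$-vector spaces for the Grothendieck topology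 generated by these coverings. For objects $V\subset W$, say that $V$ is weakly quasi-compact in $W$, written $V\overset{wc}{\to}W$, if for every covering $T$ of $W$ the family $\{W'\cap V: W'\in T\}$ has a finite refinement that is a covering of $V$. A sheaf $F$ on $X_{sa}\times S$ is c-soft if, for all objects $Y,V,W$ with $V\overset{wc}{\to}Y$, $W\overset{wc}{\to}Y$ and $V\overset{wc}{\to}W$, the natural map $$\Gamma(W;F)\longrightarrow\varinjlim_{V\overset{wc}{\to}U}\Gamma(U;F)$$ is surjective. Then for every $U\in\mathrm{op}(X_{sa})$ and $V\in\mathrm{op}(S)$ the family of c-soft sheaves is injective with respect to the functor $\Gamma(U\times V;\bullet)$ on $\mathrm{Mod}(\mathbb{C}_{X_{sa}\times S})$. That is: 1. $0$ is c-soft, and direct sums of two c-soft sheaves are c-soft; 2. every sheaf embeds into a c-soft sheaf; 3. if $0\to F'\to F\to F''\to 0$ is exact with $F'$ and $F$ c-soft, then $F''$ is c-soft; 4. if $0\to F'\to F\to F''\to 0$ is exact with $F'$ c-soft, then $0\to\Gamma(U\times V;F')\to\Gamma(U\times V;F)\to\Gamma(U\times V;F'')\to 0$ is exact. Consequently every c-soft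 sheaf $F$ is $\Gamma(U\times V;\bullet)$-acyclic: $R^n\Gamma(U\times V;F)=0$ for all $n\ge 1$. -/

import Mathlib

open CategoryTheory CategoryTheory.Limits TopologicalSpace Opposite
open scoped Manifold ContDiff ZeroObject

universe u v w

noncomputable section

/-! The following two instances give, in every universe, that complex vector spaces admit
sheafification and that sheaves of complex vector spaces form a Grothendieck abelian category. -/

instance preservesFilteredColimits_forget_moduleCat :
    PreservesFilteredColimits (forget (ModuleCat.{u} ℂ)) :=
  Limits.comp_preservesFilteredColimits (forget₂ (ModuleCat.{u} ℂ) AddCommGrpCat.{u})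
    (forget AddCommGrpCat.{u})

instance isGrothendieckAbelian_moduleCat :
    IsGrothendieckAbelian.{u} (ModuleCat.{u} ℂ) :=
  IsGrothendieckAbelian.of_equivalence
    (ModuleCat.restrictScalarsEquivalenceOfRingEquiv
      (ULift.ringEquiv.symm : ℂ ≃+* ULift.{u} ℂ))

/-- A subset `A` of a real analytic manifold `M` is semianalytic if every point of `M` has an open
neighbourhood `U` on which `A` is a finite union of sets, each defined by finitely many equations
`f = 0` and finitely many strict inequalities `g > 0` with `f`, `g` real analytic on `U`. -/
def IsSemianalytic {E H : Type*} [NormedAddCommGroup E] [NormedSpace ℝ E] [TopologicalSpace H]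
    (I : ModelWithCorners ℝ E H) {M : Type*} [TopologicalSpace M] [ChartedSpace H M]
    (A : Set M) : Prop :=
  ∀ x : M, ∃ U : Set M, IsOpen U ∧ x ∈ U ∧
    ∃ (n m : ℕ) (f g : Fin n → Fin m → M → ℝ),
      (∀ i j, ContMDiffOn I 𝓘(ℝ, ℝ) ω (f i j) U) ∧
      (∀ i j, ContMDiffOn I 𝓘(ℝ, ℝ) ω (g i j) U) ∧
      A ∩ U = {y ∈ U | ∃ i, (∀ j, f i j y = 0) ∧ (∀ j, 0 < g i j y)}

/-- A subset `A` of a real analytic manifold `X` (modelled on `E`) is subanalytic if every point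
of `X` has an open neighbourhood `U` such that `A ∩ U` is the projection to `X` of a relatively
compact semianalytic subset of `X × ℝᵈ` for some `d`. -/
def IsSubanalytic (E : Type*) [NormedAddCommGroup E] [NormedSpace ℝ E]
    {X : Type*} [TopologicalSpace X] [ChartedSpace E X] (A : Set X) : Prop :=
  ∀ x : X, ∃ U : Set X, IsOpen U ∧ x ∈ U ∧
    ∃ (d : ℕ) (B : Set (X × EuclideanSpace ℝ (Fin d))),
      IsSemianalytic (𝓘(ℝ, E).prod 𝓘(ℝ, EuclideanSpace ℝ (Fin d))) B ∧
      IsCompact (closure B) ∧ A ∩ U = Prod.fst '' B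

/-- Coverings in the subanalytic site `X_sa`: a family `T` of subanalytic open subsets of `U`
covers `U` if for every compact `K ⊆ X` some finite subfamily has the same trace on `K`
as `U`. -/
def IsSaCovering (E : Type*) [NormedAddCommGroup E] [NormedSpace ℝ E]
    {X : Type*} [TopologicalSpace X] [ChartedSpace E X] (U : Opens X) (T : Set (Opens X)) : Prop :=
  (∀ U' ∈ T, IsSubanalytic E (U' : Set X) ∧ U' ≤ U) ∧
  ∀ K : Set X, IsCompact K → ∃ T₀ ⊆ T, T₀.Finite ∧
    K ∩ (⋃ U' ∈ T₀, (U' : Set X)) = K ∩ (U : Set X)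

/-- `op(X_sa × S)`: the finite unions of products `U × V`, with `U` a subanalytic open subset
of `X` and `V` an open subset of `S`. It is ordered by inclusion, and regarded as a category
through this order. -/
abbrev RelOpen (E : Type*) [NormedAddCommGroup E] [NormedSpace ℝ E]
    (X : Type u) [TopologicalSpace X] [ChartedSpace E X]
    (S : Type v) [TopologicalSpace S] : Type (max u v) :=
  {W : Opens (X × S) // ∃ P : Set (Opens X × Opens S), P.Finite ∧
    (∀ p ∈ P, IsSubanalytic E (p.1 : Set X)) ∧
    (W : Set (X × S)) = ⋃ p ∈ P, (p.1 : Set X) ×ˢ (p.2 : Set S)}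

section RelativeSite

variable (E : Type w) [NormedAddCommGroup E] [NormedSpace ℝ E]
  {X : Type u} [TopologicalSpace X] [ChartedSpace E X] {S : Type v} [TopologicalSpace S]

/-- The product `U × V` as an object of `op(X_sa × S)`. -/
def RelOpen.box (U : Opens X) (hU : IsSubanalytic E (U : Set X)) (V : Opens S) :
    RelOpen E X S :=
  ⟨⟨(U : Set X) ×ˢ (V : Set S), U.isOpen.prod V.isOpen⟩, {(U, V)}, Set.finite_singleton _, by simpa using hU, by simp⟩

variable {E}

/-- The family `T` has a refinement `{U' × V'}` over the product `U × V`, where `U'` runs over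
a covering of `U` in `X_sa` and `V'` over an open covering of `V` in `S`. -/
def RefinedByProductCovering (T : Set (RelOpen E X S)) (U : Opens X) (V : Opens S) : Prop :=
  ∃ (𝒰 : Set (Opens X)) (𝒱 : Set (Opens S)), IsSaCovering E U 𝒰 ∧ sSup 𝒱 = V ∧
    ∀ U' ∈ 𝒰, ∀ V' ∈ 𝒱, ∃ A ∈ T, (U' : Set X) ×ˢ (V' : Set S) ⊆ (A.1 : Set (X × S))

/-- Coverings in `X_sa × S`: a family `T` of objects contained in `W` covers `W` if, for every
product `U × V ⊆ W` with `U` subanalytic open in `X` and `V` open in `S`, the trace of `T` on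
`U × V` is refined by a product covering of `U × V`. (Members of such a product covering lie
in `U × V`, so lying in a member of the trace of `T` amounts to lying in a member of `T`.) -/
def IsRelCovering (W : RelOpen E X S) (T : Set (RelOpen E X S)) : Prop :=
  (∀ A ∈ T, A ≤ W) ∧
  ∀ (U : Opens X) (V : Opens S), IsSubanalytic E (U : Set X) →
    (U : Set X) ×ˢ (V : Set S) ⊆ (W.1 : Set (X × S)) → RefinedByProductCovering T U V

/-- `V` is weakly quasi-compact in `W`: `V ⊆ W`, and the trace on `V` of any covering of `W`
has a finite refinement covering `V`. -/
def IsWC (V W : RelOpen E X S) : Prop :=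
  V ≤ W ∧ ∀ T, IsRelCovering W T →
    ∃ T' : Set (RelOpen E X S), T'.Finite ∧ IsRelCovering V T' ∧ ∀ A ∈ T', ∃ B ∈ T, A ≤ B

variable (E X S)

/-- The coverings of `X_sa × S`, as presieves. -/
def relPrecoverage : Precoverage (RelOpen E X S) where
  coverings W := {R | IsRelCovering W {A | ∃ f : A ⟶ W, R f}}

/-- The Grothendieck topology generated by the coverings of `X_sa × S`. -/
def relTopology : GrothendieckTopology (RelOpen E X S) := (relPrecoverage E X S).toGrothendieck

/-- `Mod(ℂ_{X_sa × S})`, the category of sheaves of complex vector spaces on `X_sa × S`. -/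
abbrev RelSheaf := Sheaf (relTopology E X S) (ModuleCat.{max u v} ℂ)

variable {E X S}

/-- The functor `Γ(W; •)` of sections on `W`. -/
abbrev relSections (W : RelOpen E X S) : RelSheaf E X S ⥤ ModuleCat.{max u v} ℂ :=
  (sheafSections (relTopology E X S) (ModuleCat.{max u v} ℂ)).obj (op W)

instance relSections_additive (W : RelOpen E X S) : (relSections W).Additive where
  map_add := rfl

/-- The inductive system `U ↦ Γ(U; F)`, indexed by the objects `U` in which `V` is
weakly quasi-compact. -/
def wcSystem (F : RelSheaf E X S) (V : RelOpen E X S) :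
    {U : RelOpen E X S // IsWC V U}ᵒᵖ ⥤ ModuleCat.{max u v} ℂ :=
  (Subtype.mono_coe (fun U => IsWC V U)).functor.op ⋙ F.obj

/-- A sheaf `F` on `X_sa × S` is c-soft if `Γ(W; F) → colim_{V wc→ U} Γ(U; F)` is surjective
whenever `V` and `W` are weakly quasi-compact in some object `Y`, and `V` is weakly
quasi-compact in `W`. -/
def IsCSoft (F : RelSheaf E X S) : Prop :=
  ∀ (Y V W : RelOpen E X S), IsWC V Y → IsWC W Y → ∀ hVW : IsWC V W,
    Function.Surjective (colimit.ι (wcSystem F V) (op ⟨W, hVW⟩)).hom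

end RelativeSite

/-- A full additive subcategory of an abelian category, given by the property `P`, is injective
with respect to the additive functor `Φ`: it is cogenerating, contains the cokernel of every
monomorphism between its objects, and `Φ` preserves exactness of every short exact sequence whose
first term is in the subcategory. -/
structure IsInjectiveWrt {C : Type*} [Category C] [Abelian C] {D : Type*} [Category D]
    [Abelian D] (P : ObjectProperty C) (Φ : C ⥤ D) [Φ.Additive] : Prop where
  zero : P 0
  biprod : ∀ A B : C, P A → P B → P (A ⊞ B)
  cogenerating : ∀ A : C, ∃ (B : C) (i : A ⟶ B), P B ∧ Mono i
  quotient : ∀ T : ShortComplex C, T.ShortExact → P T.X₁ → P T.X₂ → P T.X₃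
  exact : ∀ T : ShortComplex C, T.ShortExact → P T.X₁ → (T.map Φ).ShortExact

end

/-! Everything rests on a concrete form of weak quasi-compactness. Finite families cover as soon as
they cover set-theoretically, and it follows that `A` is weakly quasi-compact in `W` exactly when
`A` lies in finitely many products `U × K ⊆ W`, with `U` relatively compact subanalytic open and `K`
compact (`IsCompactlyCovered`). In this form the relation is stable under unions and intersections,
and admits interpolation because `S` is locally compact. So c-softness says that a section defined
near `V` agrees near `V` with a section on all of `W` (`isCSoft_iff`).

Let `0 → F' → F → F'' → 0` be exact with `F'` c-soft. A section of `F''` lifts locally to `F`. Two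
lifts differ on the overlap by a section of `F'`; a c-soft extension of this difference corrects one
of them, and finitely many such steps lift the section over any object weakly quasi-compact in its
domain (`IsCSoft.exists_lift`). If `F` is c-soft too, so is `F''`: lift near `V`, extend the lift in
`F`, map it back down. For exactness on a product, exhaust it by a sequence of objects and correct
successive lifts, as in a Mittag-Leffler argument, until they glue
(`IsCSoft.surjective_of_exhaustion`).

Injective sheaves have surjective restriction maps (`RelSheaf.res_surjective_of_injective`), so they
are c-soft and provide the embeddings. Acyclicity is dimension shifting along an injective
resolution whose successive kernels are c-soft (`IsInjectiveWrt.isZero_rightDerived`). -/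

/-! ### Semianalytic sets: intersections and analytic preimages. -/

section Semianalytic

variable {E H : Type*} [NormedAddCommGroup E] [NormedSpace ℝ E] [TopologicalSpace H]
  {I : ModelWithCorners ℝ E H} {M : Type*} [TopologicalSpace M] [ChartedSpace H M]

theorem IsSemianalytic.inter {A B : Set M} (hA : IsSemianalytic I A) (hB : IsSemianalytic I B) :
    IsSemianalytic I (A ∩ B) := by
  intro x
  obtain ⟨U, hU, hxU, n, m, f, g, hf, hg, hAU⟩ := hA x
  obtain ⟨V, hV, hxV, n', m', f', g', hf', hg', hBV⟩ := hB x
  -- Intersection distributes over the two unions: pieces are indexed by pairs and their conditions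
  -- are concatenated.
  refine ⟨U ∩ V, hU.inter hV, ⟨hxU, hxV⟩, n * n', m + m',
    fun i => Fin.addCases (f (finProdFinEquiv.symm i).1) (f' (finProdFinEquiv.symm i).2),
    fun i => Fin.addCases (g (finProdFinEquiv.symm i).1) (g' (finProdFinEquiv.symm i).2),
    ?_, ?_, ?_⟩
  · intro i j
    induction j using Fin.addCases with
    | left j => simpa using (hf _ j).mono Set.inter_subset_left
    | right j => simpa using (hf' _ j).mono Set.inter_subset_right
  · intro i j
    induction j using Fin.addCases with
    | left j => simpa using (hg _ j).mono Set.inter_subset_left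
    | right j => simpa using (hg' _ j).mono Set.inter_subset_right
  · ext y
    have h1 := Set.ext_iff.1 hAU y
    have h2 := Set.ext_iff.1 hBV y
    simp only [Set.mem_inter_iff, Set.mem_ofPred_eq] at h1 h2
    simp only [Set.mem_inter_iff, Set.mem_ofPred_eq, Fin.forall_fin_add, Fin.addCases_left,
      Fin.addCases_right]
    rw [← finProdFinEquiv.exists_congr_right]
    simp only [Equiv.symm_apply_apply, Prod.exists]
    constructor
    · rintro ⟨⟨ha, hb⟩, hu, hv⟩
      obtain ⟨-, i, hi⟩ := h1.1 ⟨ha, hu⟩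
      obtain ⟨-, i', hi'⟩ := h2.1 ⟨hb, hv⟩
      exact ⟨⟨hu, hv⟩, i, i', ⟨hi.1, hi'.1⟩, hi.2, hi'.2⟩
    · rintro ⟨⟨hu, hv⟩, i, i', ⟨a, b⟩, c, d⟩
      exact ⟨⟨(h1.2 ⟨hu, i, a, c⟩).1, (h2.2 ⟨hv, i', b, d⟩).1⟩, hu, hv⟩

theorem IsSemianalytic.preimage {E₂ H₂ : Type*} [NormedAddCommGroup E₂] [NormedSpace ℝ E₂]
    [TopologicalSpace H₂] {J : ModelWithCorners ℝ E₂ H₂} {N : Type*} [TopologicalSpace N]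
    [ChartedSpace H₂ N] {A : Set N} (hA : IsSemianalytic J A) {φ : M → N}
    (hφ : ContMDiff I J ω φ) : IsSemianalytic I (φ ⁻¹' A) := by
  intro x
  obtain ⟨U, hU, hxU, n, m, f, g, hf, hg, hAU⟩ := hA (φ x)
  refine ⟨φ ⁻¹' U, hU.preimage hφ.continuous, hxU, n, m, fun i j => f i j ∘ φ,
    fun i j => g i j ∘ φ, fun i j => (hf i j).comp hφ.contMDiffOn subset_rfl,
    fun i j => (hg i j).comp hφ.contMDiffOn subset_rfl, ?_⟩
  rw [← Set.preimage_inter, hAU]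
  rfl

end Semianalytic

/-! ### Subanalytic sets: intersections and small neighbourhoods. -/

section Subanalytic

variable {E : Type*} [NormedAddCommGroup E] [NormedSpace ℝ E]
  {X : Type*} [TopologicalSpace X] [ChartedSpace E X]

/-- If `A` and `B` are locally projections of `P ⊆ X × ℝᵈ` and `Q ⊆ X × ℝᵉ`, their intersection is
the projection of the fibre product of `P` and `Q` over `X`, inside `X × ℝᵈ⁺ᵉ`. -/
theorem IsSubanalytic.inter [T2Space X] {A B : Set X} (hA : IsSubanalytic E A)
    (hB : IsSubanalytic E B) : IsSubanalytic E (A ∩ B) := by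
  intro x
  obtain ⟨U, hU, hxU, d, P, hP, hPc, hAU⟩ := hA x
  obtain ⟨V, hV, hxV, e, Q, hQ, hQc, hBV⟩ := hB x
  let F₁ := EuclideanSpace ℝ (Fin d)
  let F₂ := EuclideanSpace ℝ (Fin e)
  let F := EuclideanSpace ℝ (Fin (d + e))
  let L : (F₁ × F₂) ≃L[ℝ] F := ContinuousLinearEquiv.ofFinrankEq (by simp [F₁, F₂, F])
  let p₁ : X × F → X × F₁ := fun z => (z.1, (L.symm z.2).1)
  let p₂ : X × F → X × F₂ := fun z => (z.1, (L.symm z.2).2)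
  have hp₁ : ContMDiff (𝓘(ℝ, E).prod 𝓘(ℝ, F)) (𝓘(ℝ, E).prod 𝓘(ℝ, F₁)) ω p₁ :=
    contMDiff_fst.prodMk
      (((ContinuousLinearMap.fst ℝ F₁ F₂).comp (L.symm : F →L[ℝ] F₁ × F₂)).contMDiff.comp
        contMDiff_snd)
  have hp₂ : ContMDiff (𝓘(ℝ, E).prod 𝓘(ℝ, F)) (𝓘(ℝ, E).prod 𝓘(ℝ, F₂)) ω p₂ :=
    contMDiff_fst.prodMk
      (((ContinuousLinearMap.snd ℝ F₁ F₂).comp (L.symm : F →L[ℝ] F₁ × F₂)).contMDiff.comp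
        contMDiff_snd)
  refine ⟨U ∩ V, hU.inter hV, ⟨hxU, hxV⟩, d + e, p₁ ⁻¹' P ∩ p₂ ⁻¹' Q,
    (hP.preimage hp₁).inter (hQ.preimage hp₂), ?_, ?_⟩
  -- The fibre product lies in the continuous image of the compact set `closure P ×ˢ closure Q`.
  · let q : (X × F₁) × (X × F₂) → X × F := fun z => (z.1.1, L (z.1.2, z.2.2))
    have hq : Continuous q := by fun_prop
    have hK : IsCompact (q '' (closure P ×ˢ closure Q)) := (hPc.prod hQc).image hq
    refine hK.of_isClosed_subset isClosed_closure (closure_minimal ?_ hK.isClosed)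
    rintro z ⟨h₁, h₂⟩
    exact ⟨(p₁ z, p₂ z), ⟨subset_closure h₁, subset_closure h₂⟩, by simp [q, p₁, p₂]⟩
  · have h : (A ∩ B) ∩ (U ∩ V) = (A ∩ U) ∩ (B ∩ V) := by ac_rfl
    rw [h, hAU, hBV]
    ext y
    constructor
    · rintro ⟨⟨⟨y, a⟩, ha, rfl⟩, ⟨⟨y', b⟩, hb, h⟩⟩
      obtain rfl : y' = y := h
      exact ⟨(y', L (a, b)), by simp [p₁, p₂, ha, hb], rfl⟩
    · rintro ⟨z, ⟨h₁, h₂⟩, rfl⟩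
      exact ⟨⟨_, h₁, rfl⟩, ⟨_, h₂, rfl⟩⟩

/-- Every point has a relatively compact subanalytic open neighbourhood. -/
theorem exists_isSubanalytic_nhd [FiniteDimensional ℝ E] [T2Space X] [IsManifold 𝓘(ℝ, E) ω X]
    (x : X) : ∃ U : Opens X, x ∈ U ∧ IsSubanalytic E (U : Set X) ∧
      IsCompact (closure (U : Set X)) := by
  -- The neighbourhood is a Euclidean ball: its squared norm is analytic, while the given norm of
  -- `E` need not come from an inner product.
  let L : E ≃L[ℝ] EuclideanSpace ℝ (Fin (Module.finrank ℝ E)) :=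
    ContinuousLinearEquiv.ofFinrankEq (by simp)
  let φ := chartAt E x
  let ψ := φ.trans L.toHomeomorph.toOpenPartialHomeomorph
  have hxs : x ∈ φ.source := mem_chart_source E x
  have hψs : ψ.source = φ.source := by simp [ψ]
  have hψt : IsOpen ψ.target := ψ.open_target
  have hxt : ψ x ∈ ψ.target := ψ.map_source (hψs ▸ hxs)
  obtain ⟨r, hr, hball⟩ := Metric.nhds_basis_closedBall.mem_iff.1 (hψt.mem_nhds hxt)
  let f : X → ℝ := fun y => r ^ 2 - ‖ψ y - ψ x‖ ^ 2
  have hf : ContMDiffOn 𝓘(ℝ, E) 𝓘(ℝ, ℝ) ω f φ.source := by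
    have h1 : ContMDiffOn 𝓘(ℝ, E) 𝓘(ℝ, E) ω φ φ.source := contMDiffOn_chart
    have h2 : ContDiff ℝ ω (fun z : E => r ^ 2 - ‖L z - ψ x‖ ^ 2) :=
      contDiff_const.sub ((L.contDiff.sub contDiff_const).norm_sq ℝ)
    exact h2.contMDiff.comp_contMDiffOn h1
  let A : Set X := ψ.source ∩ ψ ⁻¹' Metric.ball (ψ x) r
  have hAo : IsOpen A := ψ.isOpen_inter_preimage Metric.isOpen_ball
  have hK : IsCompact (ψ.symm '' Metric.closedBall (ψ x) r) :=
    (isCompact_closedBall _ _).image_of_continuousOn (ψ.continuousOn_symm.mono hball)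
  have hAK : A ⊆ ψ.symm '' Metric.closedBall (ψ x) r := fun y hy =>
    ⟨ψ y, Metric.ball_subset_closedBall hy.2, ψ.left_inv hy.1⟩
  have hKs : ψ.symm '' Metric.closedBall (ψ x) r ⊆ φ.source := by
    rintro _ ⟨z, hz, rfl⟩
    exact hψs ▸ ψ.map_target (hball hz)
  have hAc : IsCompact (closure A) :=
    hK.of_isClosed_subset isClosed_closure (closure_minimal hAK hK.isClosed)
  have hAs : closure A ⊆ φ.source := (closure_minimal hAK hK.isClosed).trans hKs
  refine ⟨⟨A, hAo⟩, ⟨hψs ▸ hxs, Metric.mem_ball_self hr⟩, ?_, hAc⟩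
  intro y
  refine ⟨Set.univ, isOpen_univ, trivial, 0, Prod.fst ⁻¹' A, ?_, ?_, ?_⟩
  · have hA : IsSemianalytic 𝓘(ℝ, E) A := by
      intro y
      by_cases hy : y ∈ φ.source
      · refine ⟨φ.source, φ.open_source, hy, 1, 1, fun _ _ _ => 0, fun _ _ => f,
          fun _ _ => contMDiffOn_const, fun _ _ => hf, ?_⟩
        ext z
        have : 0 < f z ↔ ψ z ∈ Metric.ball (ψ x) r := by
          rw [Metric.mem_ball, dist_eq_norm, sub_pos, sq_lt_sq₀ (norm_nonneg _) hr.le]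
        simp only [A, hψs, Set.mem_inter_iff, Set.mem_preimage, Set.mem_ofPred_eq, this]
        simp
        tauto
      -- Outside the chart the point has a neighbourhood missing `A`, described by the empty union
      -- of pieces.
      · refine ⟨(closure A)ᶜ, isClosed_closure.isOpen_compl, fun h => hy (hAs h), 0, 0,
          fun i => i.elim0, fun i => i.elim0, fun i => i.elim0, fun i => i.elim0, ?_⟩
        ext z
        simpa using fun h => subset_closure h
    exact hA.preimage contMDiff_fst
  · have : IsCompact ((closure A) ×ˢ (Set.univ : Set (EuclideanSpace ℝ (Fin 0)))) :=
      hAc.prod (Set.toFinite _).isCompact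
    refine this.of_isClosed_subset isClosed_closure (closure_minimal ?_ ?_)
    · exact fun z hz => ⟨subset_closure hz, trivial⟩
    · exact isClosed_closure.prod isClosed_univ
  · ext z
    simp

end Subanalytic

/-! ### The lattice of finite unions of products, and compactly covered inclusions. -/

section Lattice

variable {E : Type w} [NormedAddCommGroup E] [NormedSpace ℝ E]
  {X : Type u} [TopologicalSpace X] [ChartedSpace E X] {S : Type v} [TopologicalSpace S]

namespace RelOpen

/-- The union of a finite family of products, as an object of `op(X_sa × S)`. -/
def ofBoxes (P : Set (Opens X × Opens S)) (hP : P.Finite)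
    (hs : ∀ p ∈ P, IsSubanalytic E (p.1 : Set X)) : RelOpen E X S :=
  ⟨⟨⋃ p ∈ P, (p.1 : Set X) ×ˢ (p.2 : Set S),
    isOpen_biUnion fun p _ => p.1.isOpen.prod p.2.isOpen⟩, P, hP, hs, rfl⟩

@[simp]
theorem coe_ofBoxes (P : Set (Opens X × Opens S)) (hP : P.Finite)
    (hs : ∀ p ∈ P, IsSubanalytic E (p.1 : Set X)) :
    ((ofBoxes P hP hs).1 : Set (X × S)) = ⋃ p ∈ P, (p.1 : Set X) ×ˢ (p.2 : Set S) := rfl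

variable (E X S) in
/-- The empty object. -/
def empty : RelOpen E X S := ofBoxes ∅ Set.finite_empty (by simp)

@[simp]
theorem coe_empty : ((empty E X S).1 : Set (X × S)) = ∅ := by simp [empty]

theorem empty_le (W : RelOpen E X S) : empty E X S ≤ W := by
  intro z hz
  have : z ∈ ((empty E X S).1 : Set (X × S)) := hz
  simp at this

/-- The union of two objects. -/
def union (A B : RelOpen E X S) : RelOpen E X S :=
  ⟨A.1 ⊔ B.1, by
    obtain ⟨P, hP, hPs, hA⟩ := A.2
    obtain ⟨Q, hQ, hQs, hB⟩ := B.2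
    refine ⟨P ∪ Q, hP.union hQ, ?_, ?_⟩
    · rintro p (hp | hp)
      exacts [hPs p hp, hQs p hp]
    · rw [Opens.coe_sup, hA, hB, Set.biUnion_union]⟩

theorem le_union_left (A B : RelOpen E X S) : A ≤ A.union B :=
  le_sup_left (a := A.1) (b := B.1)

theorem le_union_right (A B : RelOpen E X S) : B ≤ A.union B :=
  le_sup_right (a := A.1) (b := B.1)

theorem union_le {A B C : RelOpen E X S} (hA : A ≤ C) (hB : B ≤ C) : A.union B ≤ C :=
  sup_le (a := A.1) (b := B.1) (c := C.1) hA hB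

/-- The intersection of two objects. -/
def inter [T2Space X] (A B : RelOpen E X S) : RelOpen E X S :=
  ⟨A.1 ⊓ B.1, by
    obtain ⟨P, hP, hPs, hA⟩ := A.2
    obtain ⟨Q, hQ, hQs, hB⟩ := B.2
    refine ⟨Set.image2 (fun p q => (p.1 ⊓ q.1, p.2 ⊓ q.2)) P Q, hP.image2 _ hQ, ?_, ?_⟩
    · rintro _ ⟨p, hp, q, hq, rfl⟩
      exact (hPs p hp).inter (hQs q hq)
    · rw [Opens.coe_inf, hA, hB]
      ext z
      simp only [Set.mem_inter_iff, Set.mem_iUnion, Set.mem_prod, SetLike.mem_coe, exists_prop]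
      constructor
      · rintro ⟨⟨p, hp, h⟩, ⟨q, hq, h'⟩⟩
        exact ⟨_, ⟨p, hp, q, hq, rfl⟩, ⟨h.1, h'.1⟩, h.2, h'.2⟩
      · rintro ⟨_, ⟨p, hp, q, hq, rfl⟩, h⟩
        exact ⟨⟨p, hp, h.1.1, h.2.1⟩, ⟨q, hq, h.1.2, h.2.2⟩⟩⟩

theorem inter_le_left [T2Space X] (A B : RelOpen E X S) : A.inter B ≤ A :=
  inf_le_left (a := A.1) (b := B.1)

theorem inter_le_right [T2Space X] (A B : RelOpen E X S) : A.inter B ≤ B :=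
  inf_le_right (a := A.1) (b := B.1)

theorem le_inter [T2Space X] {A B C : RelOpen E X S} (hA : C ≤ A) (hB : C ≤ B) :
    C ≤ A.inter B :=
  fun _ hz => ⟨hA hz, hB hz⟩

/-- The largest `V` with `U × V ⊆ W` is open. -/
theorem isOpen_setOf_prod_subset (W : RelOpen E X S) (U : Set X) :
    IsOpen {s : S | ∀ x ∈ U, (x, s) ∈ W.1} := by
  obtain ⟨P, hP, -, hW⟩ := W.2
  rw [isOpen_iff_mem_nhds]
  intro s hs
  -- There are finitely many products, so the second factors containing `s` still intersect in a
  -- neighbourhood of `s`.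
  have h : (⋂ p ∈ {p ∈ P | s ∈ p.2}, (p.2 : Set S)) ∈ nhds s :=
    (Filter.biInter_mem (hP.subset (Set.sep_subset _ _))).2
      fun p hp => p.2.isOpen.mem_nhds hp.2
  refine Filter.mem_of_superset h fun t ht x hx => ?_
  have hxs : (x, s) ∈ (W.1 : Set (X × S)) := hs x hx
  rw [hW] at hxs
  simp only [Set.mem_iUnion, Set.mem_prod, exists_prop] at hxs
  obtain ⟨p, hp, hx, hsp⟩ := hxs
  change (x, t) ∈ (W.1 : Set (X × S))
  rw [hW]
  simp only [Set.mem_iUnion, Set.mem_prod, exists_prop]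
  exact ⟨p, hp, hx, Set.mem_iInter₂.1 ht p ⟨hp, hsp⟩⟩

/-- The largest open `V` with `U × V ⊆ W`. -/
def slice (W : RelOpen E X S) (U : Set X) : Opens S :=
  ⟨{s : S | ∀ x ∈ U, (x, s) ∈ W.1}, W.isOpen_setOf_prod_subset U⟩

theorem prod_subset_iff_subset_slice {W : RelOpen E X S} {U : Set X} {K : Set S} :
    U ×ˢ K ⊆ (W.1 : Set (X × S)) ↔ K ⊆ (W.slice U : Set S) :=
  ⟨fun h _ hs _ hx => h ⟨hx, hs⟩, fun h z hz => h hz.2 z.1 hz.1⟩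

theorem exists_box_le {W : RelOpen E X S} {z : X × S} (hz : z ∈ W.1) :
    ∃ (U : Opens X) (V : Opens S), IsSubanalytic E (U : Set X) ∧
      (U : Set X) ×ˢ (V : Set S) ⊆ (W.1 : Set (X × S)) ∧ z.1 ∈ U ∧ z.2 ∈ V := by
  obtain ⟨P, hP, hs, hW⟩ := W.2
  have hz' : z ∈ (W.1 : Set (X × S)) := hz
  rw [hW] at hz'
  simp only [Set.mem_iUnion, exists_prop] at hz'
  obtain ⟨p, hp, hzp⟩ := hz'
  exact ⟨p.1, p.2, hs p hp, hW ▸ Set.subset_biUnion_of_mem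
    (u := fun p : Opens X × Opens S => (p.1 : Set X) ×ˢ (p.2 : Set S)) hp, hzp⟩

end RelOpen

theorem IsSubanalytic.biInter [T2Space X] {ι : Type*} {s : Set ι} (hs : s.Finite)
    {U : Set X} (hU : IsSubanalytic E U) {f : ι → Set X} (hf : ∀ i ∈ s, IsSubanalytic E (f i)) :
    IsSubanalytic E (U ∩ ⋂ i ∈ s, f i) := by
  induction s, hs using Set.Finite.induction_on with
  | empty => simpa using hU
  | @insert a s _ _ ih =>
    rw [Set.biInter_insert, Set.inter_left_comm]
    exact (hf a (by simp)).inter (ih fun i hi => hf i (by simp [hi]))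

theorem isSaCovering_of_finite {U : Opens X} {T : Set (Opens X)} (hT : T.Finite)
    (hs : ∀ U' ∈ T, IsSubanalytic E (U' : Set X) ∧ U' ≤ U) (hU : (U : Set X) ⊆ ⋃ U' ∈ T, U') :
    IsSaCovering E U T :=
  ⟨hs, fun K _ => ⟨T, subset_rfl, hT, by
    rw [(Set.iUnion₂_subset fun U' h => (hs U' h).2 : ⋃ U' ∈ T, (U' : Set X) ⊆ U).antisymm hU]⟩⟩

/-- A finite family of objects is a covering of its union. -/
theorem isRelCovering_of_finite [T2Space X] {W : RelOpen E X S} {T : Set (RelOpen E X S)}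
    (hT : T.Finite) (hle : ∀ A ∈ T, A ≤ W)
    (hW : (W.1 : Set (X × S)) ⊆ ⋃ A ∈ T, (A.1 : Set (X × S))) : IsRelCovering W T := by
  refine ⟨hle, fun U V hU hUV => ?_⟩
  choose P hP hPs hPA using fun A : RelOpen E X S => A.2
  let R := ⋃ A ∈ T, P A
  have hR : R.Finite := hT.biUnion fun A _ => hP A
  have hRs : ∀ p ∈ R, IsSubanalytic E (p.1 : Set X) := by
    intro p hp
    obtain ⟨A, -, hp⟩ := Set.mem_iUnion₂.1 hp
    exact hPs A p hp
  -- For `x` take the intersection of the first factors containing `x`, and likewise for `s`. Only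
  -- finitely many sets arise, and if `(x, s)` lies in some product, so does the product of these
  -- two intersections.
  let f : Set (Opens X × Opens S) → Set X := fun Q => (U : Set X) ∩ ⋂ p ∈ Q, (p.1 : Set X)
  let g : Set (Opens X × Opens S) → Set S := fun Q => (V : Set S) ∩ ⋂ p ∈ Q, (p.2 : Set S)
  have hfo : ∀ Q ⊆ R, IsOpen (f Q) := fun Q hQ =>
    U.isOpen.inter ((hR.subset hQ).isOpen_biInter fun p _ => p.1.isOpen)
  have hgo : ∀ Q ⊆ R, IsOpen (g Q) := fun Q hQ =>
    V.isOpen.inter ((hR.subset hQ).isOpen_biInter fun p _ => p.2.isOpen)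
  have hsub : ∀ x : X, {p ∈ R | x ∈ p.1} ⊆ R := fun x => Set.sep_subset _ _
  have hsub' : ∀ s : S, {p ∈ R | s ∈ p.2} ⊆ R := fun x => Set.sep_subset _ _
  refine ⟨{U' | (U' : Set X) ∈ (fun x => f {p ∈ R | x ∈ p.1}) '' (U : Set X)},
    {V' | (V' : Set S) ∈ (fun s => g {p ∈ R | s ∈ p.2}) '' (V : Set S)},
    isSaCovering_of_finite ?_ ?_ ?_, ?_, ?_⟩
  · refine Set.Finite.preimage SetLike.coe_injective.injOn
      ((hR.finite_subsets.image f).subset ?_)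
    rintro _ ⟨x, -, rfl⟩
    exact ⟨_, hsub x, rfl⟩
  · rintro U' ⟨x, hx, hU'⟩
    change IsSubanalytic E (U' : Set X) ∧ (U' : Set X) ⊆ U
    rw [← hU']
    exact ⟨hU.biInter (hR.subset (hsub x)) fun p hp => hRs p hp.1, Set.inter_subset_left⟩
  · intro x hx
    refine Set.mem_iUnion₂.2 ⟨⟨_, hfo _ (hsub x)⟩, ⟨x, hx, rfl⟩, hx, ?_⟩
    exact Set.mem_iInter₂.2 fun p hp => hp.2
  · refine le_antisymm (sSup_le ?_) ?_
    · rintro V' ⟨s, hs, hV'⟩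
      change (V' : Set S) ⊆ V
      rw [← hV']
      exact Set.inter_subset_left
    · intro s hs
      refine Opens.mem_sSup.2 ⟨⟨_, hgo _ (hsub' s)⟩, ⟨s, hs, rfl⟩, hs, ?_⟩
      exact Set.mem_iInter₂.2 fun p hp => hp.2
  · rintro U' ⟨x, hx, hU'⟩ V' ⟨s, hs, hV'⟩
    obtain ⟨A, hA, hxs⟩ := Set.mem_iUnion₂.1 (hW (hUV (Set.mk_mem_prod hx hs)))
    rw [hPA A] at hxs
    obtain ⟨p, hp, hxs⟩ := Set.mem_iUnion₂.1 hxs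
    have hpR : p ∈ R := Set.mem_iUnion₂.2 ⟨A, hA, hp⟩
    refine ⟨A, hA, ?_⟩
    rw [hPA A, ← hU', ← hV']
    refine subset_trans (Set.prod_mono ?_ ?_) (Set.subset_biUnion_of_mem
      (u := fun p : Opens X × Opens S => (p.1 : Set X) ×ˢ (p.2 : Set S)) hp)
    · exact Set.inter_subset_right.trans (Set.biInter_subset_of_mem ⟨hpR, hxs.1⟩)
    · exact Set.inter_subset_right.trans (Set.biInter_subset_of_mem ⟨hpR, hxs.2⟩)

theorem IsSaCovering.subset_biUnion {U : Opens X} {T : Set (Opens X)} (hT : IsSaCovering E U T) :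
    (U : Set X) ⊆ ⋃ U' ∈ T, (U' : Set X) := by
  intro x hx
  obtain ⟨T₀, h₀, -, h⟩ := hT.2 {x} isCompact_singleton
  have hx' : x ∈ {x} ∩ (⋃ U' ∈ T₀, (U' : Set X)) := h ▸ ⟨rfl, hx⟩
  exact Set.biUnion_subset_biUnion_left h₀ hx'.2

theorem IsRelCovering.subset_biUnion {W : RelOpen E X S} {T : Set (RelOpen E X S)}
    (hT : IsRelCovering W T) : (W.1 : Set (X × S)) ⊆ ⋃ A ∈ T, (A.1 : Set (X × S)) := by
  intro z hz
  obtain ⟨U, V, hU, hUV, hzU, hzV⟩ := RelOpen.exists_box_le hz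
  obtain ⟨𝒰, 𝒱, h𝒰, h𝒱, h⟩ := hT.2 U V hU hUV
  obtain ⟨U', hU', hzU'⟩ := Set.mem_iUnion₂.1 (h𝒰.subset_biUnion hzU)
  rw [← h𝒱, Opens.mem_sSup] at hzV
  obtain ⟨V', hV', hzV'⟩ := hzV
  obtain ⟨A, hA, hA'⟩ := h U' hU' V' hV'
  exact Set.mem_iUnion₂.2 ⟨A, hA, hA' ⟨hzU', hzV'⟩⟩

/-- `A` is contained in a finite union of products `U × K ⊆ W` with `U` relatively compact
subanalytic open and `K` compact. -/
def IsCompactlyCovered (A W : RelOpen E X S) : Prop :=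
  ∃ Q : Set (Opens X × Set S), Q.Finite ∧
    (∀ q ∈ Q, IsSubanalytic E (q.1 : Set X) ∧ IsCompact (closure (q.1 : Set X)) ∧
      IsCompact q.2 ∧ (q.1 : Set X) ×ˢ q.2 ⊆ (W.1 : Set (X × S))) ∧
    (A.1 : Set (X × S)) ⊆ ⋃ q ∈ Q, (q.1 : Set X) ×ˢ q.2

namespace IsCompactlyCovered

theorem le {A W : RelOpen E X S} (h : IsCompactlyCovered A W) : A ≤ W := by
  obtain ⟨Q, -, hQ, hA⟩ := h
  exact hA.trans (Set.iUnion₂_subset fun q hq => (hQ q hq).2.2.2)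

theorem mono {A A' W W' : RelOpen E X S} (h : IsCompactlyCovered A W) (hA : A' ≤ A)
    (hW : W ≤ W') : IsCompactlyCovered A' W' := by
  obtain ⟨Q, hf, hQ, h⟩ := h
  exact ⟨Q, hf, fun q hq => ⟨(hQ q hq).1, (hQ q hq).2.1, (hQ q hq).2.2.1,
    (hQ q hq).2.2.2.trans hW⟩, subset_trans hA h⟩

theorem empty (W : RelOpen E X S) : IsCompactlyCovered (RelOpen.empty E X S) W :=
  ⟨∅, Set.finite_empty, by simp, by simp⟩

theorem union {A B W : RelOpen E X S} (hA : IsCompactlyCovered A W)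
    (hB : IsCompactlyCovered B W) : IsCompactlyCovered (A.union B) W := by
  obtain ⟨P, hPf, hP, hA⟩ := hA
  obtain ⟨Q, hQf, hQ, hB⟩ := hB
  refine ⟨P ∪ Q, hPf.union hQf, ?_, ?_⟩
  · rintro q (hq | hq)
    exacts [hP q hq, hQ q hq]
  · rw [Set.biUnion_union]
    exact Set.union_subset_union hA hB

theorem inter [T2Space X] [T2Space S] {A W W' : RelOpen E X S} (h : IsCompactlyCovered A W)
    (h' : IsCompactlyCovered A W') : IsCompactlyCovered A (W.inter W') := by
  obtain ⟨P, hPf, hP, hA⟩ := h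
  obtain ⟨Q, hQf, hQ, hB⟩ := h'
  refine ⟨Set.image2 (fun p q => (p.1 ⊓ q.1, p.2 ∩ q.2)) P Q, hPf.image2 _ hQf, ?_, ?_⟩
  · rintro _ ⟨p, hp, q, hq, rfl⟩
    obtain ⟨hp1, hp2, hp3, hp4⟩ := hP p hp
    obtain ⟨hq1, hq2, hq3, hq4⟩ := hQ q hq
    exact ⟨hp1.inter hq1, hp2.of_isClosed_subset isClosed_closure
      (closure_mono Set.inter_subset_left), hp3.inter hq3,
      fun z hz => ⟨hp4 ⟨hz.1.1, hz.2.1⟩, hq4 ⟨hz.1.2, hz.2.2⟩⟩⟩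
  · intro z hz
    obtain ⟨p, hp, hzp⟩ := Set.mem_iUnion₂.1 (hA hz)
    obtain ⟨q, hq, hzq⟩ := Set.mem_iUnion₂.1 (hB hz)
    exact Set.mem_iUnion₂.2 ⟨_, ⟨p, hp, q, hq, rfl⟩, ⟨hzp.1, hzq.1⟩, hzp.2, hzq.2⟩

theorem box {U : Opens X} (hU : IsSubanalytic E (U : Set X)) (hUc : IsCompact (closure (U : Set X)))
    {V : Opens S} {K : Set S} (hK : IsCompact K) (hVK : (V : Set S) ⊆ K) {W : RelOpen E X S}
    (h : (U : Set X) ×ˢ K ⊆ (W.1 : Set (X × S))) :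
    IsCompactlyCovered (RelOpen.box E U hU V) W :=
  ⟨{(U, K)}, Set.finite_singleton _, by simpa using ⟨hU, hUc, hK, h⟩,
    by simpa [RelOpen.box] using Set.prod_mono_right hVK⟩

/-- Only the compact factor is thickened: `K` lies in the open set `W.slice U`, so a compact `L`
fits between, and the union of the `U × interior L` interpolates. The factor `U` needs no shrinking,
as its closure is required to be compact in `X` only. -/
theorem exists_between [LocallyCompactSpace S] [T2Space S] {A W : RelOpen E X S}
    (h : IsCompactlyCovered A W) :
    ∃ B, IsCompactlyCovered A B ∧ IsCompactlyCovered B W := by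
  obtain ⟨Q, hf, hQ, hA⟩ := h
  have h : ∀ q : Opens X × Set S, ∃ (V : Opens S) (L : Set S), q ∈ Q →
      q.2 ⊆ V ∧ (V : Set S) ⊆ L ∧ IsCompact L ∧ L ⊆ W.slice q.1 := by
    intro q
    by_cases hq : q ∈ Q
    · obtain ⟨L, hL, h1, h2⟩ := exists_compact_between (hQ q hq).2.2.1 (W.slice q.1).isOpen
        (RelOpen.prod_subset_iff_subset_slice.1 (hQ q hq).2.2.2)
      exact ⟨⟨interior L, isOpen_interior⟩, L, fun _ => ⟨h1, interior_subset, hL, h2⟩⟩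
    · exact ⟨⊥, ∅, fun h => absurd h hq⟩
  choose V L hVL using h
  let B : RelOpen E X S := RelOpen.ofBoxes ((fun q => (q.1, V q)) '' Q) (hf.image _)
    (by rintro _ ⟨q, hq, rfl⟩; exact (hQ q hq).1)
  have hB : (B.1 : Set (X × S)) = ⋃ q ∈ Q, (q.1 : Set X) ×ˢ (V q : Set S) := by
    simp only [B, RelOpen.coe_ofBoxes, Set.biUnion_image]
  refine ⟨B, ⟨Q, hf, fun q hq => ⟨(hQ q hq).1, (hQ q hq).2.1, (hQ q hq).2.2.1, ?_⟩, hA⟩,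
    (fun q => (q.1, L q)) '' Q, hf.image _, ?_, ?_⟩
  · rw [hB]
    exact (Set.prod_mono_right (hVL q hq).1).trans (Set.subset_biUnion_of_mem
      (u := fun q : Opens X × Set S => (q.1 : Set X) ×ˢ (V q : Set S)) hq)
  · rintro _ ⟨q, hq, rfl⟩
    exact ⟨(hQ q hq).1, (hQ q hq).2.1, (hVL q hq).2.2.1,
      RelOpen.prod_subset_iff_subset_slice.2 (hVL q hq).2.2.2⟩
  · rw [hB, Set.biUnion_image]
    exact Set.biUnion_mono subset_rfl fun q hq => Set.prod_mono_right (hVL q hq).2.1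

end IsCompactlyCovered

end Lattice

/-! ### Weak quasi-compactness, covering sieves and exhaustions. -/

section Site

variable {E : Type w} [NormedAddCommGroup E] [NormedSpace ℝ E]
  {X : Type u} [TopologicalSpace X] [ChartedSpace E X] {S : Type v} [TopologicalSpace S]

/-- A countable family of relatively compact subanalytic open subsets covers `X`. -/
theorem exists_countable_isSubanalytic_cover (E : Type w) [NormedAddCommGroup E] [NormedSpace ℝ E]
    [FiniteDimensional ℝ E] (X : Type u) [TopologicalSpace X] [T2Space X]
    [SecondCountableTopology X] [ChartedSpace E X] [IsManifold 𝓘(ℝ, E) ω X] :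
    ∃ ℬ : Set (Opens X), ℬ.Countable ∧
      (∀ B ∈ ℬ, IsSubanalytic E (B : Set X) ∧ IsCompact (closure (B : Set X))) ∧
      ⋃ B ∈ ℬ, (B : Set X) = Set.univ := by
  choose U hxU hU hUc using exists_isSubanalytic_nhd (E := E) (X := X)
  obtain ⟨T, hT, h⟩ := isOpen_iUnion_countable (fun x => (U x : Set X)) fun x => (U x).isOpen
  refine ⟨U '' T, hT.image _, ?_, ?_⟩
  · rintro _ ⟨x, -, rfl⟩
    exact ⟨hU x, hUc x⟩
  · rw [Set.biUnion_image, h]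
    exact Set.eq_univ_of_forall fun x => Set.mem_iUnion.2 ⟨x, hxU x⟩

theorem isSaCovering_inter [T2Space X] {U : Opens X} (hU : IsSubanalytic E (U : Set X))
    {ℬ : Set (Opens X)} (hℬ : ∀ B ∈ ℬ, IsSubanalytic E (B : Set X))
    (h : ⋃ B ∈ ℬ, (B : Set X) = Set.univ) : IsSaCovering E U ((fun B => U ⊓ B) '' ℬ) := by
  refine ⟨?_, fun K hK => ?_⟩
  · rintro _ ⟨B, hB, rfl⟩
    exact ⟨hU.inter (hℬ B hB), inf_le_left⟩
  · obtain ⟨T, hT, hf, hKT⟩ := hK.elim_finite_subcover_image (b := ℬ)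
      (c := fun B => (B : Set X)) (fun B _ => B.isOpen) (h ▸ Set.subset_univ K)
    refine ⟨(fun B => U ⊓ B) '' T, Set.image_mono hT, hf.image _, ?_⟩
    rw [Set.biUnion_image]
    ext x
    simp only [Set.mem_inter_iff, Set.mem_iUnion, Opens.coe_inf, exists_prop]
    constructor
    · rintro ⟨hx, B, hB, h⟩
      exact ⟨hx, h.1⟩
    · rintro ⟨hx, hxU⟩
      obtain ⟨B, hB, hxB⟩ := Set.mem_iUnion₂.1 (hKT hx)
      exact ⟨hx, B, hB, hxU, hxB⟩

/-- An open subset is the union of the open subsets which are contained in a compact part of it. -/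
theorem sSup_subset_compact [LocallyCompactSpace S] (V : Opens S) :
    sSup {V' : Opens S | ∃ K : Set S, IsCompact K ∧ (V' : Set S) ⊆ K ∧ K ⊆ V} = V := by
  refine le_antisymm (sSup_le ?_) fun s hs => ?_
  · rintro V' ⟨K, -, h, h'⟩
    exact h.trans h'
  · obtain ⟨K, hK, hsK, hKV⟩ := exists_compact_subset V.isOpen hs
    exact Opens.mem_sSup.2 ⟨⟨interior K, isOpen_interior⟩, ⟨K, hK, interior_subset, hKV⟩, hsK⟩

/-- A product refinement over `U × W.slice U` has two index families: relative compactness of `U`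
makes the first finite, compactness of `K` the second. -/
theorem IsRelCovering.exists_finite_prod_subset {W : RelOpen E X S} {T : Set (RelOpen E X S)}
    (hT : IsRelCovering W T) {U : Opens X} (hU : IsSubanalytic E (U : Set X))
    (hUc : IsCompact (closure (U : Set X))) {K : Set S} (hK : IsCompact K)
    (hUK : (U : Set X) ×ˢ K ⊆ (W.1 : Set (X × S))) :
    ∃ T₀ ⊆ T, T₀.Finite ∧ (U : Set X) ×ˢ K ⊆ ⋃ B ∈ T₀, (B.1 : Set (X × S)) := by
  obtain ⟨𝒰, 𝒱, h𝒰, h𝒱, h⟩ := hT.2 U (W.slice U) hU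
    (RelOpen.prod_subset_iff_subset_slice.2 subset_rfl)
  obtain ⟨P, hP, hPf, hPU⟩ := h𝒰.2 _ hUc
  obtain ⟨R, hR, hRf, hKR⟩ := hK.elim_finite_subcover_image (b := 𝒱)
    (c := fun V => (V : Set S)) (fun V _ => V.isOpen) (by
      intro s hs
      have : s ∈ sSup 𝒱 := h𝒱 ▸ RelOpen.prod_subset_iff_subset_slice.1 hUK hs
      simpa using this)
  choose B hBT hB using h
  have hfin : (P ×ˢ R).Finite := hPf.prod hRf
  let c : P ×ˢ R → RelOpen E X S := fun z => B z.1.1 (hP z.2.1) z.1.2 (hR z.2.2)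
  have := hfin.to_subtype
  refine ⟨Set.range c, ?_, Set.finite_range c, ?_⟩
  · rintro _ ⟨z, rfl⟩
    exact hBT _ _ _ _
  · rintro ⟨x, s⟩ ⟨hx, hs⟩
    have hx' : x ∈ closure (U : Set X) ∩ ⋃ U' ∈ P, (U' : Set X) := hPU ▸ ⟨subset_closure hx, hx⟩
    obtain ⟨U', hU', hxU'⟩ := Set.mem_iUnion₂.1 hx'.2
    obtain ⟨V', hV', hsV'⟩ := Set.mem_iUnion₂.1 (hKR hs)
    exact Set.mem_iUnion₂.2 ⟨_, ⟨⟨(U', V'), hU', hV'⟩, rfl⟩, hB _ _ _ _ ⟨hxU', hsV'⟩⟩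

theorem IsCompactlyCovered.isWC [T2Space X] {A W : RelOpen E X S}
    (h : IsCompactlyCovered A W) : IsWC A W := by
  refine ⟨h.le, fun T hT => ?_⟩
  obtain ⟨Q, hf, hQ, hA⟩ := h
  choose F hFT hFf hF using fun q (hq : q ∈ Q) =>
    hT.exists_finite_prod_subset (hQ q hq).1 (hQ q hq).2.1 (hQ q hq).2.2.1 (hQ q hq).2.2.2
  let T₀ : Set (RelOpen E X S) := ⋃ (q) (hq : q ∈ Q), F q hq
  have hT₀ : T₀.Finite := hf.biUnion' fun q hq => hFf q hq
  have hle : ∀ B ∈ A.inter '' T₀, B ≤ A := by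
    rintro _ ⟨B, -, rfl⟩
    exact A.inter_le_left B
  refine ⟨A.inter '' T₀, hT₀.image _, isRelCovering_of_finite (hT₀.image _) hle ?_, ?_⟩
  · intro z hz
    obtain ⟨q, hq, hzq⟩ := Set.mem_iUnion₂.1 (hA hz)
    obtain ⟨B, hB, hzB⟩ := Set.mem_iUnion₂.1 (hF q hq hzq)
    exact Set.mem_iUnion₂.2 ⟨_, ⟨B, Set.mem_iUnion₂.2 ⟨q, hq, hB⟩, rfl⟩, hz, hzB⟩
  · rintro _ ⟨B, hB, rfl⟩
    obtain ⟨q, hq, hB⟩ := Set.mem_iUnion₂.1 hB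
    exact ⟨B, hFT q hq hB, A.inter_le_right B⟩

theorem IsWC.isCompactlyCovered [FiniteDimensional ℝ E] [T2Space X] [SecondCountableTopology X]
    [IsManifold 𝓘(ℝ, E) ω X] [LocallyCompactSpace S] {A W : RelOpen E X S} (h : IsWC A W) :
    IsCompactlyCovered A W := by
  obtain ⟨ℬ, -, hℬ, hℬu⟩ := exists_countable_isSubanalytic_cover E X
  -- Weak quasi-compactness is tested on the family of all objects contained in a single admissible
  -- `U × K`; a finite refinement of it is the required finite cover.
  let T : Set (RelOpen E X S) := {B | ∃ (U : Opens X) (K : Set S), IsSubanalytic E (U : Set X) ∧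
    IsCompact (closure (U : Set X)) ∧ IsCompact K ∧ (U : Set X) ×ˢ K ⊆ (W.1 : Set (X × S)) ∧
    (B.1 : Set (X × S)) ⊆ (U : Set X) ×ˢ K}
  have hT : IsRelCovering W T := by
    refine ⟨?_, fun U V hU hUV => ?_⟩
    · rintro B ⟨U, K, -, -, -, h, h'⟩
      exact h'.trans h
    · refine ⟨_, _, isSaCovering_inter hU (fun B hB => (hℬ B hB).1) hℬu, sSup_subset_compact V, ?_⟩
      rintro _ ⟨B, hB, rfl⟩ V' ⟨K, hK, hVK, hKV⟩
      exact ⟨RelOpen.box E (U ⊓ B) (hU.inter (hℬ B hB).1) V', ⟨U ⊓ B, K, hU.inter (hℬ B hB).1,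
        (hℬ B hB).2.of_isClosed_subset isClosed_closure (closure_mono Set.inter_subset_right), hK,
        (Set.prod_mono Set.inter_subset_left hKV).trans hUV, Set.prod_mono_right hVK⟩, subset_rfl⟩
  obtain ⟨T', hT'f, hT', hTT'⟩ := h.2 T hT
  have : ∀ B ∈ T', ∃ q : Opens X × Set S, IsSubanalytic E (q.1 : Set X) ∧
      IsCompact (closure (q.1 : Set X)) ∧ IsCompact q.2 ∧
      (q.1 : Set X) ×ˢ q.2 ⊆ (W.1 : Set (X × S)) ∧ (B.1 : Set (X × S)) ⊆ (q.1 : Set X) ×ˢ q.2 := by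
    intro B hB
    obtain ⟨C, ⟨U, K, h1, h2, h3, h4, h5⟩, hBC⟩ := hTT' B hB
    exact ⟨(U, K), h1, h2, h3, h4, subset_trans hBC h5⟩
  choose q h1 h2 h3 h4 h5 using this
  have := hT'f.to_subtype
  refine ⟨Set.range fun B : T' => q B.1 B.2, Set.finite_range _, ?_, ?_⟩
  · rintro _ ⟨B, rfl⟩
    exact ⟨h1 _ _, h2 _ _, h3 _ _, h4 _ _⟩
  · intro z hz
    obtain ⟨B, hB, hzB⟩ := Set.mem_iUnion₂.1 (hT'.subset_biUnion hz)
    exact Set.mem_iUnion₂.2 ⟨_, ⟨⟨B, hB⟩, rfl⟩, h5 B hB hzB⟩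

/-- A sieve on `W` is locally finite if, for every relatively compact subanalytic open `U` and
every `s` with `U × {s} ⊆ W`, it contains finitely many products `U' × V` which cover `U × V` for
some neighbourhood `V` of `s`. -/
def IsLocallyFiniteSieve {W : RelOpen E X S} (R : Sieve W) : Prop :=
  ∀ U : Opens X, IsSubanalytic E (U : Set X) → IsCompact (closure (U : Set X)) →
    ∀ s ∈ W.slice U, ∃ V : Opens S, s ∈ V ∧ ∃ 𝒰 : Set (Opens X), 𝒰.Finite ∧
      (∀ U' ∈ 𝒰, IsSubanalytic E (U' : Set X) ∧ U' ≤ U) ∧ (U : Set X) ⊆ ⋃ U' ∈ 𝒰, (U' : Set X) ∧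
      ∀ U' ∈ 𝒰, ∃ (B : RelOpen E X S) (f : B ⟶ W), R f ∧
        (U' : Set X) ×ˢ (V : Set S) ⊆ (B.1 : Set (X × S))

theorem isLocallyFiniteSieve_of_isRelCovering {W : RelOpen E X S} {R : Sieve W}
    {T : Set (RelOpen E X S)} (hT : IsRelCovering W T) (hR : ∀ B ∈ T, ∃ f : B ⟶ W, R f) :
    IsLocallyFiniteSieve R := by
  intro U hU hUc s hs
  obtain ⟨𝒰, 𝒱, h𝒰, h𝒱, h⟩ := hT.2 U (W.slice U) hU
    (RelOpen.prod_subset_iff_subset_slice.2 subset_rfl)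
  obtain ⟨P, hP, hPf, hPU⟩ := h𝒰.2 _ hUc
  rw [← h𝒱, Opens.mem_sSup] at hs
  obtain ⟨V, hV, hsV⟩ := hs
  refine ⟨V, hsV, P, hPf, fun U' h' => h𝒰.1 U' (hP h'), fun x hx => ?_, fun U' hU' => ?_⟩
  · have hx' : x ∈ closure (U : Set X) ∩ ⋃ U' ∈ P, (U' : Set X) := hPU ▸ ⟨subset_closure hx, hx⟩
    exact hx'.2
  · obtain ⟨B, hB, hUB⟩ := h U' (hP hU') V hV
    obtain ⟨f, hf⟩ := hR B hB
    exact ⟨B, f, hf, hUB⟩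

theorem IsLocallyFiniteSieve.pullback {W W' : RelOpen E X S} {R : Sieve W}
    (hR : IsLocallyFiniteSieve R) (f : W' ⟶ W) : IsLocallyFiniteSieve (R.pullback f) := by
  intro U hU hUc s hs
  obtain ⟨V, hsV, 𝒰, hf, h𝒰, hUc, h⟩ := hR U hU hUc s fun x hx => leOfHom f (hs x hx)
  refine ⟨V ⊓ W'.slice U, ⟨hsV, hs⟩, 𝒰, hf, h𝒰, hUc, fun U' hU' => ?_⟩
  obtain ⟨B, g, hg, hB⟩ := h U' hU'
  let B' := RelOpen.box E U' (h𝒰 U' hU').1 (V ⊓ W'.slice U)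
  have hBB' : B' ≤ B := (Set.prod_mono_right Set.inter_subset_left).trans hB
  have hBW' : B' ≤ W' := fun z hz => hz.2.2 z.1 ((h𝒰 U' hU').2 hz.1)
  exact ⟨B', homOfLE hBW', R.downward_closed hg (homOfLE hBB'), subset_rfl⟩

/-- The condition is pointwise in `s`, so the neighbourhoods of `s` attached to the finitely many
`U'` can be intersected. -/
theorem IsLocallyFiniteSieve.transitive {W : RelOpen E X S} {R R' : Sieve W}
    (hR : IsLocallyFiniteSieve R)
    (h : ∀ ⦃B⦄ ⦃f : B ⟶ W⦄, R f → IsLocallyFiniteSieve (R'.pullback f)) :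
    IsLocallyFiniteSieve R' := by
  intro U hU hUc s hs
  obtain ⟨V, hsV, 𝒰, hf, h𝒰, hU𝒰, hB⟩ := hR U hU hUc s hs
  have : ∀ U' ∈ 𝒰, ∃ V' : Opens S, s ∈ V' ∧ ∃ 𝒰' : Set (Opens X), 𝒰'.Finite ∧
      (∀ U'' ∈ 𝒰', IsSubanalytic E (U'' : Set X) ∧ U'' ≤ U') ∧
      (U' : Set X) ⊆ ⋃ U'' ∈ 𝒰', (U'' : Set X) ∧
      ∀ U'' ∈ 𝒰', ∃ (B : RelOpen E X S) (f : B ⟶ W), R' f ∧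
        (U'' : Set X) ×ˢ (V' : Set S) ⊆ (B.1 : Set (X × S)) := by
    intro U' hU'
    obtain ⟨B, f, hf, hUB⟩ := hB U' hU'
    obtain ⟨V', hsV', 𝒰', h1, h2, h3, h4⟩ := h hf U' (h𝒰 U' hU').1
      (hUc.of_isClosed_subset isClosed_closure (closure_mono (h𝒰 U' hU').2)) s
      fun x hx => hUB ⟨hx, hsV⟩
    refine ⟨V', hsV', 𝒰', h1, h2, h3, fun U'' hU'' => ?_⟩
    obtain ⟨C, g, hg, hC⟩ := h4 U'' hU''
    exact ⟨C, g ≫ f, hg, hC⟩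
  choose V' hsV' 𝒰' h1 h2 h3 h4 using this
  have := hf.to_subtype
  refine ⟨⟨⋂ U' : 𝒰, (V' U'.1 U'.2 : Set S), isOpen_iInter_of_finite fun U' => (V' _ _).isOpen⟩,
    Set.mem_iInter.2 fun U' => hsV' _ _, ⋃ (U') (hU' : U' ∈ 𝒰), 𝒰' U' hU',
    hf.biUnion' fun U' hU' => h1 U' hU', ?_, ?_, ?_⟩
  · intro U'' hU''
    obtain ⟨U', hU', hU''⟩ := Set.mem_iUnion₂.1 hU''
    exact ⟨(h2 U' hU' U'' hU'').1, (h2 U' hU' U'' hU'').2.trans (h𝒰 U' hU').2⟩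
  · intro x hx
    obtain ⟨U', hU', hxU'⟩ := Set.mem_iUnion₂.1 (hU𝒰 hx)
    obtain ⟨U'', hU'', hxU''⟩ := Set.mem_iUnion₂.1 (h3 U' hU' hxU')
    exact Set.mem_iUnion₂.2 ⟨U'', Set.mem_iUnion₂.2 ⟨U', hU', hU''⟩, hxU''⟩
  · intro U'' hU''
    obtain ⟨U', hU', hU''⟩ := Set.mem_iUnion₂.1 hU''
    obtain ⟨B, f, hf, hB⟩ := h4 U' hU' U'' hU''
    exact ⟨B, f, hf, (Set.prod_mono_right (Set.iInter_subset _ (⟨U', hU'⟩ : 𝒰))).trans hB⟩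

/-- Covering sieves of the generated topology arise from coverings by pullback and composition;
local finiteness survives both, so it controls all of them. -/
theorem isLocallyFiniteSieve_of_mem {W : RelOpen E X S} {R : Sieve W}
    (hR : R ∈ relTopology E X S W) : IsLocallyFiniteSieve R := by
  induction hR with
  | of W R hR =>
    exact isLocallyFiniteSieve_of_isRelCovering hR fun B ⟨f, hf⟩ => ⟨f, Sieve.le_generate R _ _ hf⟩
  | top W =>
    exact fun U hU _ s hs => ⟨W.slice U, hs, {U}, Set.finite_singleton U, by simpa using hU,
      by simp, by
        rintro _ rfl
        exact ⟨W, 𝟙 W, trivial, RelOpen.prod_subset_iff_subset_slice.2 subset_rfl⟩⟩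
  | pullback W R hR W' f ih => exact ih.pullback f
  | transitive W R R' hR hR' ih ih' => exact ih.transitive ih'

theorem mem_relTopology_of_isRelCovering {W : RelOpen E X S} {R : Sieve W}
    {T : Set (RelOpen E X S)} (hT : IsRelCovering W T) (hR : ∀ B ∈ T, ∃ f : B ⟶ W, R f) :
    R ∈ relTopology E X S W := by
  have h : Sieve.generate (fun B (_ : B ⟶ W) => B ∈ T) ∈ relTopology E X S W := by
    refine Precoverage.generate_mem_toGrothendieck ?_
    change IsRelCovering W _
    convert hT using 1
    ext B
    exact ⟨fun ⟨_, h⟩ => h, fun h => ⟨homOfLE (hT.1 B h), h⟩⟩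
  refine GrothendieckTopology.superset_covering _ ?_ h
  rw [Sieve.generate_le_iff]
  intro B f hB
  obtain ⟨g, hg⟩ := hR B hB
  rwa [Subsingleton.elim f g]

/-- Induction along a covering: a property of objects, stable under passing to smaller objects and
under unions up to shrinking, and true on the members of a covering sieve of `W`, holds for every
object which is weakly quasi-compact in `W`. -/
theorem IsCompactlyCovered.induction_on_sieve [T2Space X] [LocallyCompactSpace S] [T2Space S]
    {A W : RelOpen E X S} (hA : IsCompactlyCovered A W) {R : Sieve W}
    (hR : R ∈ relTopology E X S W) {p : RelOpen E X S → Prop} (hp₀ : p (RelOpen.empty E X S))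
    (hmono : ∀ ⦃B C⦄, B ≤ C → p C → p B) (hRp : ∀ ⦃B⦄ (f : B ⟶ W), R f → p B)
    (hunion : ∀ B B' C C', IsCompactlyCovered B B' → IsCompactlyCovered C C' → B' ≤ W → C' ≤ W →
      p B' → p C' → p (B.union C)) : p A := by
  -- The property is strengthened to leave room: `Z` sits in some `B` compactly covered in a `B'`
  -- satisfying `p`. Interpolation recreates this room after each union.
  let q : Set (X × S) → Prop := fun Z => ∃ B B' : RelOpen E X S, Z ⊆ (B.1 : Set (X × S)) ∧
    IsCompactlyCovered B B' ∧ B' ≤ W ∧ p B'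
  have hq₀ : q ∅ := ⟨_, _, Set.empty_subset _, .empty _, RelOpen.empty_le _, hp₀⟩
  have hqm : ∀ ⦃Z Z'⦄, Z ⊆ Z' → q Z' → q Z := fun Z Z' h ⟨B, B', h1, h2⟩ => ⟨B, B', h.trans h1, h2⟩
  have hqu : ∀ ⦃Z Z'⦄, q Z → q Z' → q (Z ∪ Z') := by
    rintro Z Z' ⟨B, B', hZ, hB, hBW, hpB⟩ ⟨C, C', hZ', hC, hCW, hpC⟩
    obtain ⟨B₁, hBB₁, hB₁⟩ := hB.exists_between
    obtain ⟨C₁, hCC₁, hC₁⟩ := hC.exists_between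
    exact ⟨B.union C, B₁.union C₁, Set.union_subset_union hZ hZ',
      (hBB₁.mono le_rfl (RelOpen.le_union_left _ _)).union
        (hCC₁.mono le_rfl (RelOpen.le_union_right _ _)),
      RelOpen.union_le (hB₁.le.trans hBW) (hC₁.le.trans hCW), hunion _ _ _ _ hB₁ hC₁ hBW hCW hpB hpC⟩
  have hqU : ∀ {ι : Type (max u v)} {s : Set ι} (_ : s.Finite) {Z : ι → Set (X × S)},
      (∀ i ∈ s, q (Z i)) → q (⋃ i ∈ s, Z i) := by
    intro ι s hs Z
    induction s, hs using Set.Finite.induction_on with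
    | empty => simpa using hq₀
    | @insert a s _ _ ih =>
      intro h
      rw [Set.biUnion_insert]
      exact hqu (h a (by simp)) (ih fun i hi => h i (by simp [hi]))
  suffices h : q (A.1 : Set (X × S)) by
    obtain ⟨B, B', h1, h2, -, h3⟩ := h
    exact hmono (le_trans (b := B) h1 h2.le) h3
  obtain ⟨Q, hf, hQ, hA⟩ := hA
  refine hqm hA (hqU hf fun r hr => ?_)
  obtain ⟨hr1, hr2, hr3, hr4⟩ := hQ r hr
  -- With the factor `U` fixed, compact induction on `K` reduces to a neighbourhood of one point
  -- `s`, where local finiteness applies.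
  refine hr3.induction_on (p := fun K => q ((r.1 : Set X) ×ˢ K)) (by simpa using hq₀)
    (fun K K' h => hqm (Set.prod_mono_right h)) (fun K K' h h' => by
      rw [Set.prod_union]
      exact hqu h h') ?_
  intro s hs
  obtain ⟨V, hsV, 𝒰, h𝒰f, h𝒰, hU, h⟩ := isLocallyFiniteSieve_of_mem hR r.1 hr1 hr2 s
    (RelOpen.prod_subset_iff_subset_slice.1 hr4 hs)
  obtain ⟨K, hK, hsK, hKV⟩ := exists_compact_subset V.isOpen hsV
  refine ⟨interior K, mem_nhdsWithin_of_mem_nhds (isOpen_interior.mem_nhds hsK), ?_⟩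
  -- The lift matches the single index universe in which `hqU` is stated.
  have hsub : (r.1 : Set X) ×ˢ interior K ⊆
      ⋃ i ∈ (ULift.up.{max u v} '' 𝒰), (i.down : Set X) ×ˢ interior K := by
    rw [Set.biUnion_image]
    rintro ⟨x, t⟩ ⟨hx, ht⟩
    obtain ⟨U', hU', hxU'⟩ := Set.mem_iUnion₂.1 (hU hx)
    exact Set.mem_iUnion₂.2 ⟨U', hU', hxU', ht⟩
  refine hqm hsub (hqU (h𝒰f.image _) ?_)
  rintro _ ⟨U', hU', rfl⟩
  obtain ⟨B, f, hfR, hUB⟩ := h U' hU'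
  have hUc : IsCompact (closure (U' : Set X)) :=
    hr2.of_isClosed_subset isClosed_closure (closure_mono (h𝒰 U' hU').2)
  exact ⟨RelOpen.box E U' (h𝒰 U' hU').1 ⟨interior K, isOpen_interior⟩, B, subset_rfl,
    .box _ hUc hK interior_subset ((Set.prod_mono_right hKV).trans hUB), leOfHom f, hRp f hfR⟩

/-- A product is exhausted by a sequence of objects, each weakly quasi-compact in the next. -/
theorem RelOpen.exists_exhaustion [FiniteDimensional ℝ E] [T2Space X] [SecondCountableTopology X]
    [IsManifold 𝓘(ℝ, E) ω X] [LocallyCompactSpace S] [T2Space S] [SecondCountableTopology S]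
    {U : Opens X} (hU : IsSubanalytic E (U : Set X)) (V : Opens S) :
    ∃ W : ℕ → RelOpen E X S, (∀ n, IsCompactlyCovered (W n) (W (n + 1))) ∧
      (∀ n, IsCompactlyCovered (W n) (box E U hU V)) ∧ IsRelCovering (box E U hU V) (Set.range W) := by
  set Y := box E U hU V
  obtain ⟨ℬ, hℬc, hℬ, hℬu⟩ := exists_countable_isSubanalytic_cover E X
  obtain ⟨𝒱, h𝒱c, h𝒱, h𝒱V⟩ : ∃ 𝒱 : Set (Opens S), 𝒱.Countable ∧
      (∀ V' ∈ 𝒱, ∃ K : Set S, IsCompact K ∧ (V' : Set S) ⊆ K ∧ K ⊆ V) ∧ sSup 𝒱 = V := by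
    obtain ⟨T, hT, h⟩ := isOpen_iUnion_countable
      (fun V' : {V' : Opens S | ∃ K : Set S, IsCompact K ∧ (V' : Set S) ⊆ K ∧ K ⊆ V} =>
        (V'.1 : Set S)) fun V' => V'.1.isOpen
    refine ⟨Subtype.val '' T, hT.image _, ?_, ?_⟩
    · rintro _ ⟨V', -, rfl⟩
      exact V'.2
    · refine Eq.trans ?_ (sSup_subset_compact V)
      apply SetLike.coe_injective
      rw [Opens.coe_sSup, Opens.coe_sSup, Set.biUnion_image, h, Set.biUnion_eq_iUnion]
  have hcount : (ℬ ×ˢ 𝒱).Countable := hℬc.prod h𝒱c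
  have hA : ∀ p : Opens X × Opens S, ∃ A : RelOpen E X S, IsCompactlyCovered A Y ∧
      (p ∈ ℬ ×ˢ 𝒱 → ((U ⊓ p.1 : Opens X) : Set X) ×ˢ (p.2 : Set S) ⊆ (A.1 : Set (X × S))) := by
    intro p
    by_cases hp : p ∈ ℬ ×ˢ 𝒱
    · obtain ⟨K, hK, hpK, hKV⟩ := h𝒱 p.2 hp.2
      have hs := hU.inter (hℬ p.1 hp.1).1
      exact ⟨box E (U ⊓ p.1) hs p.2, .box hs ((hℬ p.1 hp.1).2.of_isClosed_subset isClosed_closure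
        (closure_mono Set.inter_subset_right)) hK hpK (Set.prod_mono Set.inter_subset_left hKV),
        fun _ => subset_rfl⟩
    · exact ⟨empty E X S, .empty _, fun h => absurd h hp⟩
  choose A hAY hA using hA
  obtain ⟨e, he⟩ : ∃ e : ℕ → RelOpen E X S, (∀ n, IsCompactlyCovered (e n) Y) ∧
      ∀ p ∈ ℬ ×ˢ 𝒱, ∃ n, A p = e n := by
    obtain ⟨e, he⟩ := ((hcount.image A).insert (empty E X S)).exists_eq_range
      (Set.insert_nonempty _ _)
    refine ⟨e, fun n => ?_, fun p hp => ?_⟩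
    · have : e n ∈ insert (empty E X S) (A '' ℬ ×ˢ 𝒱) := he ▸ Set.mem_range_self n
      rcases this with h | ⟨p, -, h⟩
      · exact h ▸ .empty _
      · exact h ▸ hAY p
    · have : A p ∈ Set.range e := he ▸ Set.mem_insert_of_mem _ ⟨p, hp, rfl⟩
      exact this.imp fun _ => Eq.symm
  -- Each new term absorbs the next basic piece `e n` and, by interpolation, stays compactly covered
  -- in `Y`.
  have hstep : ∀ B : {B : RelOpen E X S // IsCompactlyCovered B Y}, ∀ n,
      ∃ C : {C : RelOpen E X S // IsCompactlyCovered C Y},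
        IsCompactlyCovered (B.1.union (e n)) C.1 := by
    intro B n
    obtain ⟨C, hC, hC'⟩ := (B.2.union (he.1 n)).exists_between
    exact ⟨⟨C, hC'⟩, hC⟩
  choose next hnext using hstep
  let W : ℕ → {B : RelOpen E X S // IsCompactlyCovered B Y} :=
    fun n => Nat.rec ⟨empty E X S, .empty _⟩ (fun n B => next B n) n
  have hW : ∀ n, IsCompactlyCovered ((W n).1.union (e n)) (W (n + 1)).1 := fun n => hnext (W n) n
  have hWW : ∀ n, IsCompactlyCovered (W n).1 (W (n + 1)).1 := fun n =>
    (hW n).mono (le_union_left _ _) le_rfl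
  refine ⟨fun n => (W n).1, hWW, fun n => (W n).2, ?_, fun U' V' hU' hUV => ?_⟩
  · rintro _ ⟨n, rfl⟩
    exact (W n).2.le
  -- An empty `U'` puts no constraint on `V'`; otherwise `V' ≤ V`.
  · rcases (U' : Set X).eq_empty_or_nonempty with h | ⟨x, hx⟩
    · exact ⟨∅, {V'}, isSaCovering_of_finite Set.finite_empty (by simp) (by simp [h]), by simp,
        by simp⟩
    refine ⟨_, (fun V'' => V' ⊓ V'') '' 𝒱,
      isSaCovering_inter hU' (fun B hB => (hℬ B hB).1) hℬu, ?_, ?_⟩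
    · rw [sSup_image, ← inf_sSup_eq, h𝒱V]
      exact inf_eq_left.2 fun s hs => (hUV (Set.mk_mem_prod hx hs)).2
    · rintro _ ⟨B, hB, rfl⟩ _ ⟨V'', hV'', rfl⟩
      obtain ⟨n, hn⟩ := he.2 (B, V'') ⟨hB, hV''⟩
      refine ⟨_, ⟨n + 1, rfl⟩, subset_trans ?_ ((le_union_right _ _).trans (hW n).le)⟩
      rw [← hn]
      refine subset_trans ?_ (hA (B, V'') ⟨hB, hV''⟩)
      rintro ⟨y, t⟩ ⟨⟨hy, hyB⟩, ht, htV⟩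
      exact ⟨⟨(hUV (Set.mk_mem_prod hy ht)).1, hyB⟩, htV⟩

end Site

/-! ### Sections, gluing and local lifting. -/

section Sheaves

variable {E : Type w} [NormedAddCommGroup E] [NormedSpace ℝ E]
  {X : Type u} [TopologicalSpace X] [ChartedSpace E X] {S : Type v} [TopologicalSpace S]

namespace RelSheaf

/-- Restriction of sections. -/
def res (F : RelSheaf E X S) {A B : RelOpen E X S} (h : A ≤ B) :
    F.obj.obj (op B) →ₗ[ℂ] F.obj.obj (op A) :=
  (F.obj.map (homOfLE h).op).hom

/-- The action of a morphism of sheaves on sections. -/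
def app {F G : RelSheaf E X S} (f : F ⟶ G) (A : RelOpen E X S) :
    F.obj.obj (op A) →ₗ[ℂ] G.obj.obj (op A) :=
  (f.hom.app (op A)).hom

@[simp]
theorem res_res (F : RelSheaf E X S) {A B C : RelOpen E X S} (h : A ≤ B) (h' : B ≤ C)
    (s : F.obj.obj (op C)) : F.res h (F.res h' s) = F.res (h.trans h') s := by
  change ((F.obj.map (homOfLE h').op ≫ F.obj.map (homOfLE h).op).hom s) = _
  rw [← F.obj.map_comp]
  rfl

@[simp]
theorem res_self (F : RelSheaf E X S) {A : RelOpen E X S} (h : A ≤ A) (s : F.obj.obj (op A)) :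
    F.res h s = s := by
  change (F.obj.map (𝟙 (op A))).hom s = s
  rw [F.obj.map_id]
  rfl

theorem app_res {F G : RelSheaf E X S} (f : F ⟶ G) {A B : RelOpen E X S} (h : A ≤ B)
    (s : F.obj.obj (op B)) : app f A (F.res h s) = G.res h (app f B s) := by
  change (F.obj.map (homOfLE h).op ≫ f.hom.app (op A)).hom s = _
  rw [f.hom.naturality]
  rfl

theorem app_comp {F G H : RelSheaf E X S} (f : F ⟶ G) (g : G ⟶ H) (A : RelOpen E X S)
    (s : F.obj.obj (op A)) : app (f ≫ g) A s = app g A (app f A s) := rfl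

theorem app_add {F G : RelSheaf E X S} (f g : F ⟶ G) (A : RelOpen E X S)
    (s : F.obj.obj (op A)) : app (f + g) A s = app f A s + app g A s := rfl

theorem app_id (F : RelSheaf E X S) (A : RelOpen E X S) (s : F.obj.obj (op A)) :
    app (𝟙 F) A s = s := rfl

theorem app_zero (F G : RelSheaf E X S) (A : RelOpen E X S) (s : F.obj.obj (op A)) :
    app (0 : F ⟶ G) A s = 0 := rfl

theorem existsUnique_glue (F : RelSheaf E X S) {ι : Type*} {W : RelOpen E X S}
    {A : ι → RelOpen E X S} (hA : ∀ i, A i ≤ W) (hW : IsRelCovering W (Set.range A))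
    (s : ∀ i, F.obj.obj (op (A i)))
    (hs : ∀ i j B (hi : B ≤ A i) (hj : B ≤ A j), F.res hi (s i) = F.res hj (s j)) :
    ∃! t : F.obj.obj (op W), ∀ i, F.res (hA i) t = s i := by
  have hF := (isSheaf_iff_isSheaf_of_type _ _).1
    ((Presheaf.isSheaf_iff_isSheaf_forget (relTopology E X S) F.obj
      (forget (ModuleCat.{max u v} ℂ))).1 F.property)
  let π : ∀ i, A i ⟶ W := fun i => homOfLE (hA i)
  have h : Sieve.generate (Presieve.ofArrows A π) ∈ relTopology E X S W :=
    mem_relTopology_of_isRelCovering hW (by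
      rintro _ ⟨i, rfl⟩
      exact ⟨π i, Sieve.le_generate _ _ _ (Presieve.ofArrows.mk i)⟩)
  have h' := (Presieve.isSheafFor_iff_generate (Presieve.ofArrows A π)).2 (hF _ h)
  exact (Presieve.isSheafFor_arrows_iff _ _).1 h' s fun i j Z gi gj _ =>
    hs i j Z (leOfHom gi) (leOfHom gj)

theorem exists_glue (F : RelSheaf E X S) {ι : Type*} {W : RelOpen E X S}
    {A : ι → RelOpen E X S} (hA : ∀ i, A i ≤ W) (hW : IsRelCovering W (Set.range A))
    (s : ∀ i, F.obj.obj (op (A i)))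
    (hs : ∀ i j B (hi : B ≤ A i) (hj : B ≤ A j), F.res hi (s i) = F.res hj (s j)) :
    ∃ t : F.obj.obj (op W), ∀ i, F.res (hA i) t = s i :=
  (F.existsUnique_glue hA hW s hs).exists

theorem ext_of_covering (F : RelSheaf E X S) {ι : Type*} {W : RelOpen E X S}
    {A : ι → RelOpen E X S} (hA : ∀ i, A i ≤ W) (hW : IsRelCovering W (Set.range A))
    {t t' : F.obj.obj (op W)} (h : ∀ i, F.res (hA i) t = F.res (hA i) t') : t = t' :=
  (F.existsUnique_glue hA hW (fun i => F.res (hA i) t') (by simp)).unique h fun _ => rfl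

theorem isRelCovering_union [T2Space X] (A B : RelOpen E X S) :
    IsRelCovering (A.union B) (Set.range fun b : Bool => cond b A B) := by
  refine isRelCovering_of_finite (Set.finite_range _) ?_ ?_
  · rintro _ ⟨b, rfl⟩
    cases b
    exacts [RelOpen.le_union_right A B, RelOpen.le_union_left A B]
  · rintro z (hz | hz)
    · exact Set.mem_iUnion₂.2 ⟨A, ⟨true, rfl⟩, hz⟩
    · exact Set.mem_iUnion₂.2 ⟨B, ⟨false, rfl⟩, hz⟩

theorem exists_glue_union [T2Space X] (F : RelSheaf E X S) {A B : RelOpen E X S}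
    (a : F.obj.obj (op A)) (b : F.obj.obj (op B))
    (h : F.res (A.inter_le_left B) a = F.res (A.inter_le_right B) b) :
    ∃ t : F.obj.obj (op (A.union B)), F.res (RelOpen.le_union_left A B) t = a ∧
      F.res (RelOpen.le_union_right A B) t = b := by
  have h' : ∀ C (hA : C ≤ A) (hB : C ≤ B), F.res hA a = F.res hB b := by
    intro C hA hB
    have := congrArg (F.res (RelOpen.le_inter hA hB)) h
    simpa using this
  obtain ⟨t, ht⟩ := F.exists_glue (A := fun b : Bool => cond b A B) (W := A.union B)
    (by rintro (_ | _); exacts [RelOpen.le_union_right A B, RelOpen.le_union_left A B])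
    (isRelCovering_union A B) (fun i => match i with | true => a | false => b) (by
      rintro (_ | _) (_ | _) C hi hj
      exacts [rfl, (h' C hj hi).symm, h' C hi hj, rfl])
  exact ⟨t, ht true, ht false⟩

theorem ext_union [T2Space X] (F : RelSheaf E X S) {A B : RelOpen E X S}
    {t t' : F.obj.obj (op (A.union B))}
    (h : F.res (RelOpen.le_union_left A B) t = F.res (RelOpen.le_union_left A B) t')
    (h' : F.res (RelOpen.le_union_right A B) t = F.res (RelOpen.le_union_right A B) t') :
    t = t' :=
  F.ext_of_covering (A := fun b : Bool => cond b A B)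
    (by rintro (_ | _); exacts [RelOpen.le_union_right A B, RelOpen.le_union_left A B])
    (isRelCovering_union A B) (by rintro (_ | _); exacts [h', h])

end RelSheaf

instance (W : RelOpen E X S) : PreservesFiniteLimits (relSections (E := E) W) :=
  have : PreservesLimitsOfSize.{0, 0} ((evaluation (RelOpen E X S)ᵒᵖ (ModuleCat.{max u v} ℂ)).obj
      (op W)) := inferInstance
  have : PreservesFiniteLimits (sheafToPresheaf (relTopology E X S) (ModuleCat.{max u v} ℂ)) :=
    inferInstance
  have : PreservesFiniteLimits ((evaluation (RelOpen E X S)ᵒᵖ (ModuleCat.{max u v} ℂ)).obj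
      (op W)) := PreservesLimitsOfSize0.preservesFiniteLimits _
  comp_preservesFiniteLimits (sheafToPresheaf (relTopology E X S) (ModuleCat.{max u v} ℂ))
    ((evaluation _ _).obj (op W))

variable {T : ShortComplex (RelSheaf E X S)}

theorem RelSheaf.exists_app_eq (hT : T.ShortExact)
    {A : RelOpen E X S} {s : T.X₂.obj.obj (op A)} (hs : RelSheaf.app T.g A s = 0) :
    ∃ r : T.X₁.obj.obj (op A), RelSheaf.app T.f A r = s :=
  (ShortComplex.moduleCat_exact_iff (T.map (relSections A))).1
    (hT.exact.map_of_mono_of_preservesKernel (relSections A) hT.mono_f inferInstance) s hs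

theorem RelSheaf.app_app (T : ShortComplex (RelSheaf E X S)) {A : RelOpen E X S}
    (r : T.X₁.obj.obj (op A)) : app T.g A (app T.f A r) = 0 := by
  rw [← app_comp, T.zero, app_zero]

theorem RelSheaf.exists_sieve (hT : T.ShortExact)
    {A : RelOpen E X S} (s : T.X₃.obj.obj (op A)) :
    ∃ R ∈ relTopology E X S A, ∀ ⦃B⦄ (f : B ⟶ A), R f →
      ∃ t, RelSheaf.app T.g B t = T.X₃.res (leOfHom f) s := by
  have := hT.epi_g
  have : Sheaf.IsLocallySurjective T.g := (Sheaf.isLocallySurjective_iff_epi' _ T.g).2 this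
  exact ⟨_, Presheaf.imageSieve_mem (relTopology E X S) T.g.hom (U := op A) s,
    fun B f ⟨t, ht⟩ => ⟨t, ht⟩⟩

/-! ### c-soft sheaves: extension, lifting and exactness. -/

section CSoft

variable [FiniteDimensional ℝ E] [T2Space X] [SecondCountableTopology X]
  [IsManifold 𝓘(ℝ, E) ω X] [LocallyCompactSpace S] [T2Space S]

/-- Stability under intersection is read off from compact products. It lets elements of the colimit
be treated as germs of sections along `V`. -/
instance (V : RelOpen E X S) : IsFilteredOrEmpty {U : RelOpen E X S // IsWC V U}ᵒᵖ := by
  have : IsCodirectedOrder {U : RelOpen E X S // IsWC V U} := ⟨fun U U' =>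
    ⟨⟨U.1.inter U'.1, (U.2.isCompactlyCovered.inter U'.2.isCompactlyCovered).isWC⟩,
      U.1.inter_le_left U'.1, U.1.inter_le_right U'.1⟩⟩
  infer_instance

/-- c-softness in terms of sections. -/
theorem isCSoft_iff (F : RelSheaf E X S) : IsCSoft F ↔ ∀ ⦃Y V W U : RelOpen E X S⦄,
    IsCompactlyCovered W Y → IsCompactlyCovered V W → IsCompactlyCovered V U →
    ∀ t : F.obj.obj (op U), ∃ (s : F.obj.obj (op W)) (Z : RelOpen E X S) (hU : Z ≤ U)
      (hW : Z ≤ W), IsCompactlyCovered V Z ∧ F.res hW s = F.res hU t := by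
  constructor
  · intro h Y V W U hWY hVW hVU t
    have hVY := hVW.mono le_rfl hWY.le
    have : Nonempty {U : RelOpen E X S // IsWC V U} := ⟨⟨W, hVW.isWC⟩⟩
    have : IsFiltered {U : RelOpen E X S // IsWC V U}ᵒᵖ := { }
    obtain ⟨s, hs⟩ := h Y V W hVY.isWC hWY.isWC hVW.isWC
      ((colimit.ι (wcSystem F V) (op ⟨U, hVU.isWC⟩)).hom t)
    obtain ⟨Z, f, g, hfg⟩ := (Concrete.colimit_rep_eq_iff_exists (wcSystem F V)
      (i := op ⟨W, hVW.isWC⟩) (j := op ⟨U, hVU.isWC⟩) s t).1 hs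
    exact ⟨s, Z.unop.1, leOfHom g.unop, leOfHom f.unop, Z.unop.2.isCompactlyCovered, hfg⟩
  · intro h Y V W hVY hWY hVW x
    have : Nonempty {U : RelOpen E X S // IsWC V U} := ⟨⟨W, hVW⟩⟩
    have : IsFiltered {U : RelOpen E X S // IsWC V U}ᵒᵖ := { }
    obtain ⟨U, t, rfl⟩ := Concrete.colimit_exists_rep (wcSystem F V) x
    obtain ⟨s, Z, hU, hW, hVZ, hst⟩ := h hWY.isCompactlyCovered hVW.isCompactlyCovered
      U.unop.2.isCompactlyCovered t
    refine ⟨s, (Concrete.colimit_rep_eq_iff_exists (wcSystem F V)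
      (i := op ⟨W, hVW⟩) (j := U) s t).2
      ⟨op ⟨Z, hVZ.isWC⟩, Quiver.Hom.op (homOfLE hW), Quiver.Hom.op (homOfLE hU), hst⟩⟩

theorem IsCSoft.exists_extension {F : RelSheaf E X S} (hF : IsCSoft F) {Y V W U : RelOpen E X S}
    (hWY : IsCompactlyCovered W Y) (hVW : IsCompactlyCovered V W) (hVU : IsCompactlyCovered V U)
    (t : F.obj.obj (op U)) :
    ∃ s : F.obj.obj (op W), F.res hVW.le s = F.res hVU.le t := by
  obtain ⟨s, Z, hU, hW, hVZ, h⟩ := (isCSoft_iff F).1 hF hWY hVW hVU t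
  exact ⟨s, by simpa using congrArg (F.res hVZ.le) h⟩

/-- Agreement on `V` alone suffices: applied to some `Z` between `V` and `W.inter U`, it gives
agreement near `V`. -/
theorem IsCSoft.of_exists_extension {F : RelSheaf E X S}
    (h : ∀ ⦃Y V W U : RelOpen E X S⦄ (_ : IsCompactlyCovered W Y) (hVW : IsCompactlyCovered V W)
      (hVU : IsCompactlyCovered V U) (t : F.obj.obj (op U)),
      ∃ s : F.obj.obj (op W), F.res hVW.le s = F.res hVU.le t) : IsCSoft F := by
  refine (isCSoft_iff F).2 fun Y V W U hWY hVW hVU t => ?_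
  obtain ⟨Z, hVZ, hZ⟩ := (hVW.inter hVU).exists_between
  obtain ⟨s, hs⟩ := h hWY (hZ.mono le_rfl (RelOpen.inter_le_left W U))
    (hZ.mono le_rfl (RelOpen.inter_le_right W U)) t
  exact ⟨s, Z, _, _, hVZ, hs⟩

theorem isCSoft_zero : IsCSoft (0 : RelSheaf E X S) :=
  IsCSoft.of_exists_extension fun _ _ W U _ _ hVU t => ⟨0, by
    have : t = 0 := by
      rw [← RelSheaf.app_id _ _ t, (isZero_zero (RelSheaf E X S)).eq_of_src (𝟙 0) 0,
        RelSheaf.app_zero]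
    rw [this, map_zero, map_zero]⟩

theorem IsCSoft.biprod {F G : RelSheaf E X S} (hF : IsCSoft F) (hG : IsCSoft G) :
    IsCSoft (F ⊞ G) := by
  refine IsCSoft.of_exists_extension fun Y V W U hWY hVW hVU t => ?_
  obtain ⟨a, ha⟩ := hF.exists_extension hWY hVW hVU (RelSheaf.app biprod.fst U t)
  obtain ⟨b, hb⟩ := hG.exists_extension hWY hVW hVU (RelSheaf.app biprod.snd U t)
  refine ⟨RelSheaf.app biprod.inl W a + RelSheaf.app biprod.inr W b, ?_⟩
  rw [map_add, ← RelSheaf.app_res, ← RelSheaf.app_res, ha, hb, RelSheaf.app_res,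
    RelSheaf.app_res, ← map_add]
  congr 1
  conv_rhs => rw [← RelSheaf.app_id _ _ t, ← biprod.total, RelSheaf.app_add, RelSheaf.app_comp,
    RelSheaf.app_comp]

/-- Liftability is proved by induction along a sieve of local lifts. At a union, the lifts differ on
the overlap by a section of `T.X₁`, and an extension of that section corrects one of them. -/
theorem IsCSoft.exists_lift (hT : T.ShortExact) (h₁ : IsCSoft T.X₁) {A W : RelOpen E X S}
    (hAW : IsCompactlyCovered A W) (s : T.X₃.obj.obj (op W)) :
    ∃ t : T.X₂.obj.obj (op A), RelSheaf.app T.g A t = T.X₃.res hAW.le s := by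
  obtain ⟨W', hAW', hW'⟩ := hAW.exists_between
  obtain ⟨R, hR, hRs⟩ := RelSheaf.exists_sieve hT (T.X₃.res hW'.le s)
  let p : RelOpen E X S → Prop := fun B => ∃ h : B ≤ W',
    ∃ t : T.X₂.obj.obj (op B), RelSheaf.app T.g B t = T.X₃.res (h.trans hW'.le) s
  suffices h : p A from h.2
  refine hAW'.induction_on_sieve (p := p) hR ?_ ?_ ?_ ?_
  · refine ⟨RelOpen.empty_le _, ?_⟩
    have : ∀ t : T.X₃.obj.obj (op (RelOpen.empty E X S)), t = 0 := fun t =>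
      T.X₃.ext_of_covering (ι := PEmpty.{1}) (A := fun i => i.elim) (fun i => i.elim)
        (isRelCovering_of_finite (Set.finite_range _) (by simp) (by simp)) fun i => i.elim
    exact ⟨0, (this _).trans (this _).symm⟩
  · rintro B C hBC ⟨hC, t, ht⟩
    exact ⟨hBC.trans hC, T.X₂.res hBC t, by rw [RelSheaf.app_res, ht, RelSheaf.res_res]⟩
  · intro B f hf
    obtain ⟨t, ht⟩ := hRs f hf
    exact ⟨leOfHom f, t, by simpa using ht⟩
  · rintro B B' C C' hB hC hBW hCW ⟨_, b, hb⟩ ⟨_, c, hc⟩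
    refine ⟨RelOpen.union_le (hB.le.trans hBW) (hC.le.trans hCW), ?_⟩
    obtain ⟨r, hr⟩ := RelSheaf.exists_app_eq hT (A := B'.inter C')
      (s := T.X₂.res (B'.inter_le_left C') b - T.X₂.res (B'.inter_le_right C') c) (by
        rw [map_sub, RelSheaf.app_res, RelSheaf.app_res, hb, hc, RelSheaf.res_res,
          RelSheaf.res_res, sub_self])
    have hB' : IsCompactlyCovered (B.inter C) B' := hB.mono (B.inter_le_left C) le_rfl
    have hC' : IsCompactlyCovered (B.inter C) C' := hC.mono (B.inter_le_right C) le_rfl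
    -- The difference is extended to `D` and not just to `B`, since `B.inter C` need not be weakly
    -- quasi-compact in `B`.
    obtain ⟨D, hD, hDW⟩ := (hB.mono le_rfl hBW).exists_between
    have hDY := hDW.mono le_rfl hW'.le
    obtain ⟨r', hr'⟩ := h₁.exists_extension hDY (hD.mono (B.inter_le_left C) le_rfl)
      (hB'.inter hC') r
    obtain ⟨t, htB, htC⟩ := T.X₂.exists_glue_union
      (T.X₂.res hB.le b - RelSheaf.app T.f B (T.X₁.res hD.le r')) (T.X₂.res hC.le c) (by
        rw [map_sub, ← RelSheaf.app_res]
        simp only [RelSheaf.res_res]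
        rw [hr', RelSheaf.app_res, hr]
        simp)
    refine ⟨t, T.X₃.ext_union ?_ ?_⟩
    · rw [← RelSheaf.app_res, htB, map_sub, RelSheaf.app_app, RelSheaf.app_res, hb]
      simp
    · rw [← RelSheaf.app_res, htC, RelSheaf.app_res, hc]
      simp

/-- A section of `T.X₃` near `V` lifts near `V`; the lift extends in `T.X₂`, and its image is the
extension sought. -/
theorem IsCSoft.quotient (hT : T.ShortExact) (h₁ : IsCSoft T.X₁) (h₂ : IsCSoft T.X₂) :
    IsCSoft T.X₃ := by
  refine IsCSoft.of_exists_extension fun Y V W U hWY hVW hVU t => ?_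
  obtain ⟨U', hVU', hU'⟩ := hVU.exists_between
  obtain ⟨b, hb⟩ := h₁.exists_lift hT hU' t
  obtain ⟨s, hs⟩ := h₂.exists_extension hWY hVW hVU' b
  refine ⟨RelSheaf.app T.g W s, ?_⟩
  rw [← RelSheaf.app_res, hs, RelSheaf.app_res, hb, RelSheaf.res_res]

theorem IsCSoft.surjective_of_exhaustion (hT : T.ShortExact) (h₁ : IsCSoft T.X₁)
    {Y : RelOpen E X S} {W : ℕ → RelOpen E X S}
    (hW : ∀ n, IsCompactlyCovered (W n) (W (n + 1))) (hWY : ∀ n, IsCompactlyCovered (W n) Y)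
    (hY : IsRelCovering Y (Set.range W)) : Function.Surjective (RelSheaf.app T.g Y) := by
  intro s
  let L : ℕ → Type _ := fun n =>
    {t : T.X₂.obj.obj (op (W n)) // RelSheaf.app T.g (W n) t = T.X₃.res (hWY n).le s}
  have hmono : Monotone W := monotone_nat_of_le_succ fun n => (hW n).le
  -- The difference of two lifts lives on `W (n + 1)`, and its extension to `W (n + 2)` agrees with
  -- it only on `W n`; one index is lost.
  have hstep : ∀ n (t : L (n + 1)), ∃ t' : L (n + 2),
      T.X₂.res (hmono (by omega : n ≤ n + 2)) t'.1 = T.X₂.res (hW n).le t.1 := by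
    intro n t
    obtain ⟨b, hb⟩ := h₁.exists_lift hT (hWY (n + 2)) s
    obtain ⟨r, hr⟩ := RelSheaf.exists_app_eq hT (A := W (n + 1))
      (s := t.1 - T.X₂.res (hW (n + 1)).le b) (by
        rw [map_sub, t.2, RelSheaf.app_res, hb, RelSheaf.res_res, sub_self])
    obtain ⟨r', hr'⟩ := h₁.exists_extension (hWY (n + 2))
      ((hW n).mono le_rfl (hW (n + 1)).le) (hW n) r
    refine ⟨⟨b + RelSheaf.app T.f _ r', ?_⟩, ?_⟩
    · rw [map_add, hb, RelSheaf.app_app, add_zero]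
    · rw [map_add, ← RelSheaf.app_res, hr', RelSheaf.app_res, hr, map_sub, RelSheaf.res_res]
      simp
  choose next hnext using hstep
  obtain ⟨b, hb⟩ := h₁.exists_lift hT (hWY 1) s
  let t : ∀ n, L (n + 1) := fun n => Nat.rec ⟨b, hb⟩ (fun n a => next n a) n
  have ht : ∀ n, T.X₂.res (hmono (by omega : n ≤ n + 2)) (t (n + 1)).1 =
      T.X₂.res (hW n).le (t n).1 := fun n => hnext n (t n)
  -- Restricting each lift by one index turns this agreement into strict compatibility.
  let σ : ∀ n, T.X₂.obj.obj (op (W n)) := fun n => T.X₂.res (hW n).le (t n).1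
  have hσ : ∀ m n (h : m ≤ n), T.X₂.res (hmono h) (σ n) = σ m := by
    intro m n h
    induction n, h using Nat.le_induction with
    | base => simp
    | succ n h ih =>
      rw [← ih]
      have : T.X₂.res (hW n).le (σ (n + 1)) = σ n := by
        simp only [σ, RelSheaf.res_res]
        exact ht n
      rw [← this]
      simp
  obtain ⟨τ, hτ⟩ := T.X₂.exists_glue (fun n => (hWY n).le) hY σ (by
    intro i j B hi hj
    rcases le_total i j with h | h
    · rw [← hσ i j h, RelSheaf.res_res]
    · exact (T.X₂.res_res hj (hmono h) (σ i)).symm.trans (congrArg (T.X₂.res hj) (hσ j i h)))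
  refine ⟨τ, T.X₃.ext_of_covering (fun n => (hWY n).le) hY fun n => ?_⟩
  rw [← RelSheaf.app_res, hτ]
  simp only [σ]
  rw [RelSheaf.app_res, (t n).2, RelSheaf.res_res]

theorem IsCSoft.shortExact_map [SecondCountableTopology S] (hT : T.ShortExact) (h₁ : IsCSoft T.X₁)
    {U : Opens X} (hU : IsSubanalytic E (U : Set X)) (V : Opens S) :
    (T.map (relSections (RelOpen.box E U hU V))).ShortExact := by
  obtain ⟨W, hW, hWY, hY⟩ := RelOpen.exists_exhaustion hU V
  have := hT.mono_f
  exact {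
    exact := hT.exact.map_of_mono_of_preservesKernel _ hT.mono_f inferInstance
    mono_f := inferInstanceAs (Mono ((relSections _).map T.f))
    epi_g := (ModuleCat.epi_iff_surjective _).2 (h₁.surjective_of_exhaustion hT hW hWY hY) }

end CSoft

end Sheaves

noncomputable section

/-! ### Injective sheaves are c-soft. -/

section Injective

variable {E : Type w} [NormedAddCommGroup E] [NormedSpace ℝ E]
  {X : Type u} [TopologicalSpace X] [ChartedSpace E X] {S : Type v} [TopologicalSpace S]

/-- The presheaf of vector spaces freely generated by the presheaf represented by `W`. -/
def freePresheaf (W : RelOpen E X S) : (RelOpen E X S)ᵒᵖ ⥤ ModuleCat.{max u v} ℂ where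
  obj A := ModuleCat.of ℂ ((A.unop ⟶ W) →₀ ℂ)
  map f := ModuleCat.ofHom (Finsupp.lmapDomain ℂ ℂ fun g => f.unop ≫ g)
  map_id A := by
    ext : 1
    refine Finsupp.lhom_ext fun g c => ?_
    simp [Finsupp.lmapDomain_apply, Finsupp.mapDomain_single]
  map_comp f g := by
    ext : 1
    refine Finsupp.lhom_ext fun g c => ?_
    simp [Finsupp.lmapDomain_apply, Finsupp.mapDomain_single]

/-- Functoriality of `freePresheaf`. -/
def freePresheafMap {U W : RelOpen E X S} (h : U ⟶ W) : freePresheaf U ⟶ freePresheaf W where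
  app A := ModuleCat.ofHom (Finsupp.lmapDomain ℂ ℂ fun g => g ≫ h)
  naturality A B f := by
    ext : 1
    refine Finsupp.lhom_ext fun g c => ?_
    change Finsupp.mapDomain _ (Finsupp.mapDomain _ (Finsupp.single g c)) =
      Finsupp.mapDomain _ (Finsupp.mapDomain _ (Finsupp.single g c))
    simp only [Finsupp.mapDomain_single]
    rfl

instance {U W : RelOpen E X S} (h : U ⟶ W) : Mono (freePresheafMap h) := by
  have : ∀ A, Mono ((freePresheafMap h).app A) := fun A =>
    (ModuleCat.mono_iff_injective _).2
      (Finsupp.mapDomain_injective fun _ _ _ => Subsingleton.elim _ _)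
  exact NatTrans.mono_of_mono_app _

/-- The morphism from `freePresheaf W` given by a section on `W`. -/
def freePresheafDesc {W : RelOpen E X S} {F : (RelOpen E X S)ᵒᵖ ⥤ ModuleCat.{max u v} ℂ}
    (s : F.obj (op W)) : freePresheaf W ⟶ F where
  app A := ModuleCat.ofHom (Finsupp.linearCombination ℂ fun g : A.unop ⟶ W => (F.map g.op).hom s)
  naturality A B f := by
    ext : 1
    refine Finsupp.lhom_ext fun g c => ?_
    simp [freePresheaf, Finsupp.lmapDomain_apply, Finsupp.mapDomain_single,
      Finsupp.linearCombination_single]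

/-- Sections of an injective sheaf extend to larger objects. -/
theorem RelSheaf.res_surjective_of_injective (F : RelSheaf E X S) [Injective F]
    {U W : RelOpen E X S} (h : U ≤ W) : Function.Surjective (F.res h) := by
  intro s
  let L := presheafToSheaf (relTopology E X S) (ModuleCat.{max u v} ℂ)
  let adj := sheafificationAdjunction (relTopology E X S) (ModuleCat.{max u v} ℂ)
  let ι := freePresheafMap (homOfLE h)
  let φ : L.obj (freePresheaf U) ⟶ F := (adj.homEquiv _ _).symm (freePresheafDesc s)
  -- Sheafification preserves the monomorphism `ι`, so `φ` extends along it; the image of the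
  -- generator `𝟙 W` is the extended section.
  let ψ : L.obj (freePresheaf W) ⟶ F := Injective.factorThru φ (L.map ι)
  have hψ : ι ≫ adj.homEquiv _ _ ψ = freePresheafDesc s := by
    rw [← adj.homEquiv_naturality_left, Injective.comp_factorThru, Equiv.apply_symm_apply]
  let t : F.obj.obj (op W) := ((adj.homEquiv _ _ ψ).app (op W)).hom (Finsupp.single (𝟙 W) (1 : ℂ))
  refine ⟨t, ?_⟩
  have h1 := congrArg (fun k => (k.app (op U)).hom (Finsupp.single (𝟙 U) (1 : ℂ))) hψ
  have h2 := ConcreteCategory.congr_hom ((adj.homEquiv _ _ ψ).naturality (homOfLE h).op)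
    (Finsupp.single (𝟙 W) (1 : ℂ))
  have h3 : ((freePresheafDesc s).app (op U)).hom (Finsupp.single (𝟙 U) (1 : ℂ)) = s := by
    change Finsupp.linearCombination ℂ (fun g : U ⟶ U => (F.obj.map g.op).hom s) _ = s
    rw [Finsupp.linearCombination_single, one_smul, op_id, F.obj.map_id]
    rfl
  have h4 : (ι.app (op U)).hom (Finsupp.single (𝟙 U) (1 : ℂ)) =
      ((freePresheaf W).map (homOfLE h).op).hom (Finsupp.single (𝟙 W) (1 : ℂ)) := by
    change Finsupp.mapDomain _ (Finsupp.single _ _) = Finsupp.mapDomain _ (Finsupp.single _ _)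
    simp only [Finsupp.mapDomain_single]
    rfl
  calc F.res h t = ((adj.homEquiv _ _ ψ).app (op U)).hom
        (((freePresheaf W).map (homOfLE h).op).hom (Finsupp.single (𝟙 W) (1 : ℂ))) := h2.symm
    _ = ((adj.homEquiv _ _ ψ).app (op U)).hom
        ((ι.app (op U)).hom (Finsupp.single (𝟙 U) (1 : ℂ))) := by rw [h4]
    _ = s := h1.trans h3

variable [FiniteDimensional ℝ E] [T2Space X] [SecondCountableTopology X]
  [IsManifold 𝓘(ℝ, E) ω X] [LocallyCompactSpace S] [T2Space S]

theorem isCSoft_of_injective (F : RelSheaf E X S) [Injective F] : IsCSoft F :=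
  IsCSoft.of_exists_extension fun Y V W U _ hVW hVU t => by
    obtain ⟨s, hs⟩ := F.res_surjective_of_injective (W.inter_le_left U)
      (F.res (W.inter_le_right U) t)
    have hV : V ≤ W.inter U := RelOpen.le_inter hVW.le hVU.le
    exact ⟨s, by simpa using congrArg (F.res hV) hs⟩

end Injective

/-! ### Dimension shifting. -/

section Acyclic

variable {C : Type*} [Category C] [Abelian C] {D : Type*} [Category D] [Abelian D]

/-- Invariance under isomorphism is not an axiom; it comes from the quotient property applied to `0
→ 0 → A → B → 0`. -/
theorem IsInjectiveWrt.of_iso {P : ObjectProperty C} {Φ : C ⥤ D} [Φ.Additive]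
    (h : IsInjectiveWrt P Φ) {A B : C} (e : A ≅ B) (hA : P A) : P B := by
  let T : ShortComplex C := ShortComplex.mk (0 : (0 : C) ⟶ A) e.hom zero_comp
  refine h.quotient T ?_ h.zero hA
  exact {
    exact := (ShortComplex.exact_iff_mono T rfl).2 (inferInstanceAs (Mono e.hom))
    mono_f := inferInstanceAs (Mono (0 : (0 : C) ⟶ A))
    epi_g := inferInstanceAs (Epi e.hom) }

theorem CategoryTheory.ShortComplex.kernel_ι_comp_kernelLift (T : ShortComplex C) :
    kernel.ι T.f ≫ kernel.lift T.g T.f T.zero = 0 := by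
  simp [← cancel_mono (kernel.ι T.g)]

/-- An exact sequence yields a short exact sequence of kernels. -/
theorem CategoryTheory.ShortComplex.Exact.shortExact_kernelLift {T : ShortComplex C}
    (hT : T.Exact) : (ShortComplex.mk _ _ T.kernel_ι_comp_kernelLift).ShortExact := by
  have : Epi (kernel.lift T.g T.f T.zero) := (T.exact_iff_epi_kernel_lift).1 hT
  refine ShortComplex.ShortExact.mk' ?_ inferInstance this
  let φ : ShortComplex.mk (kernel.ι T.f) (kernel.lift T.g T.f T.zero)
      T.kernel_ι_comp_kernelLift ⟶
      ShortComplex.mk (kernel.ι T.f) T.f (kernel.condition _) :=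
    { τ₁ := 𝟙 (kernel T.f)
      τ₂ := 𝟙 T.X₁
      τ₃ := kernel.ι T.g
      comm₁₂ := (Category.id_comp _).trans (Category.comp_id _).symm
      comm₂₃ := (Category.id_comp _).trans (kernel.lift_ι _ _ _).symm }
  have : Epi φ.τ₁ := inferInstanceAs (Epi (𝟙 _))
  have : IsIso φ.τ₂ := inferInstanceAs (IsIso (𝟙 _))
  have : Mono φ.τ₃ := inferInstanceAs (Mono (kernel.ι _))
  exact (ShortComplex.exact_iff_of_epi_of_isIso_of_mono φ).2 (ShortComplex.exact_kernel T.f)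

/-- An additive functor which preserves kernels, and short exactness of the sequence of kernels,
preserves exactness. -/
theorem CategoryTheory.ShortComplex.exact_map_of_epi_kernelLift (Φ : C ⥤ D) [Φ.Additive]
    [PreservesFiniteLimits Φ] (T : ShortComplex C)
    (h : Epi (Φ.map (kernel.lift T.g T.f T.zero))) : (T.map Φ).Exact := by
  have hK := (ShortComplex.exact_kernel T.g).map_of_mono_of_preservesKernel Φ
    (inferInstanceAs (Mono (kernel.ι T.g))) inferInstance
  let φ : T.map Φ ⟶ (ShortComplex.mk _ _ (kernel.condition T.g)).map Φ :=
    { τ₁ := Φ.map (kernel.lift T.g T.f T.zero)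
      τ₂ := 𝟙 (Φ.obj T.X₂)
      τ₃ := 𝟙 (Φ.obj T.X₃)
      comm₁₂ := ((Φ.map_comp _ _).symm.trans (congrArg Φ.map (kernel.lift_ι _ _ _))).trans
        (Category.comp_id _).symm
      comm₂₃ := (Category.id_comp _).trans (Category.comp_id _).symm }
  have : Epi φ.τ₁ := h
  have : IsIso φ.τ₂ := inferInstanceAs (IsIso (𝟙 _))
  have : Mono φ.τ₃ := inferInstanceAs (Mono (𝟙 _))
  exact (ShortComplex.exact_iff_of_epi_of_isIso_of_mono φ).2 hK

/-- If `P` is injective with respect to `Φ` and contains the injective objects, then the objects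
of `P` are acyclic for `Φ`. -/
theorem IsInjectiveWrt.isZero_rightDerived [HasInjectiveResolutions C] {P : ObjectProperty C}
    {Φ : C ⥤ D} [Φ.Additive] [PreservesFiniteLimits Φ] (h : IsInjectiveWrt P Φ)
    (hI : ∀ A : C, Injective A → P A)
    {A : C} (hA : P A) (n : ℕ) : IsZero ((Φ.rightDerived (n + 1)).obj A) := by
  let I := injectiveResolution A
  -- The kernel in degree `0` is `A`; each later one is the quotient of an injective object by the
  -- preceding kernel.
  have hP : ∀ n, P (kernel (I.cocomplex.d n (n + 1))) := by
    intro n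
    induction n with
    | zero =>
      exact h.of_iso (IsLimit.conePointUniqueUpToIso I.isLimitKernelFork
        (limit.isLimit (parallelPair (I.cocomplex.d 0 1) 0))) hA
    | succ n ih =>
      exact h.quotient _ (I.exact_succ n).shortExact_kernelLift ih (hI _ (I.injective n))
  refine IsZero.of_iso ?_ (I.isoRightDerivedObj Φ (n + 1))
  refine (HomologicalComplex.exactAt_iff_isZero_homology _ _).1 ?_
  rw [HomologicalComplex.exactAt_iff' _ n (n + 1) (n + 2) (by simp) (by simp)]
  -- Since the degree `n` kernel satisfies `P`, the epimorphism from the degree `n` term onto the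
  -- degree `n + 1` kernel stays epi under `Φ`.
  exact ShortComplex.exact_map_of_epi_kernelLift Φ (ShortComplex.mk _ _ (I.complex_d_comp n))
    (h.exact _ (I.exact_succ n).shortExact_kernelLift (hP n)).epi_g

end Acyclic

end

theorem mainTheorem6
    {E : Type*} [NormedAddCommGroup E] [NormedSpace ℝ E] [FiniteDimensional ℝ E]
    {E' : Type*} [NormedAddCommGroup E'] [NormedSpace ℝ E'] [FiniteDimensional ℝ E']
    (X : Type u) [TopologicalSpace X] [T2Space X] [SecondCountableTopology X]
    [ChartedSpace E X] [IsManifold 𝓘(ℝ, E) ω X]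
    (S : Type v) [TopologicalSpace S] [T2Space S] [SecondCountableTopology S]
    [ChartedSpace E' S] [IsManifold 𝓘(ℝ, E') ω S]
    (U : Opens X) (hU : IsSubanalytic E (U : Set X)) (V : Opens S) :
    IsInjectiveWrt (fun F : RelSheaf E X S => IsCSoft F) (relSections (RelOpen.box E U hU V)) ∧
    ∀ F : RelSheaf E X S, IsCSoft F → ∀ n : ℕ, 1 ≤ n →
      IsZero (((relSections (RelOpen.box E U hU V)).rightDerived n).obj F) := by
  have : LocallyCompactSpace S := by
    have := FiniteDimensional.proper ℝ E'
    exact ChartedSpace.locallyCompactSpace E' S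
  have h : IsInjectiveWrt (fun F : RelSheaf E X S => IsCSoft F)
      (relSections (RelOpen.box E U hU V)) :=
    { zero := isCSoft_zero
      biprod := fun _ _ => IsCSoft.biprod
      cogenerating := fun A => ⟨Injective.under A, Injective.ι A, isCSoft_of_injective _,
        inferInstance⟩
      quotient := fun _ => IsCSoft.quotient
      exact := fun _ hT h₁ => h₁.shortExact_map hT hU V }
  refine ⟨h, fun F hF n hn => ?_⟩
  obtain ⟨n, rfl⟩ := Nat.exists_eq_add_of_le' hn
  exact h.isZero_rightDerived (fun A _ => isCSoft_of_injective A) hF n
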